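/- Let $f:\mathbb{R}^d\to\mathbb{R}$ be convex and twice differentiable with $\|\nabla^2 f(z)-\nabla^2 f(z')\|\le L\|z-z'\|$ for all $z,z'$, where $L>0$, and let $z^*$ be a minimizer of $f$, $z_0$ a starting point that is not a minimizer, $\|z_0-z^*\|\le D$. For a function $g$, $M>0$ and a positive semidefinite $H$, let $\mathrm{CRN}^{g}_M(\bar z,H)$ be the (unique) $z$ with $\nabla g(\bar z)+H(z-\bar z)+\frac M2\|z-\bar z\|(z-\bar z)=0$; computing such a point is called a step. MS-Solver$(\bar z)$, with parameters $K,M,m,\gamma$: put $g(z)=f(z)+\frac{\gamma}{3}\|z-\bar z\|^3$ and $z^{(0)}=\mathrm{CRN}^g_L(\bar z,\nabla^2g(\bar z))$; for $s=0,\dots,S-1$ with $S=\lceil K/m\rceil$ put $z_{s,0}=z^{(s)}$, $z_{s,t+1}=\mathrm{CRN}^g_M(z_{s,t},\nabla^2g(z_{s,0}))$ for $0\le t<m$, and $z^{(s+1)}=\frac1m\sum_{t=1}^m z_{s,t}$; return $\mathrm{CRN}^g_L(z^{(S)},\nabla^2g(z^{(S)}))$. One call uses $Sm+2$ steps and $S+2$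 Hessian evaluations. A-LEN, with $\alpha>1$: put $v_0=\bar z_0=z_0$, $A_0=0$, $\tilde z_1=\text{MS-Solver}(\bar z_0)$, $\lambda_1'=\lambda_1=\gamma\|\tilde z_1-\bar z_0\|$. For $t=0,1,2,\dots$: $a_{t+1}'=\frac{1}{2\lambda_{t+1}'}\bigl(1+\sqrt{1+4\lambda_{t+1}'A_t}\bigr)$, $A_{t+1}'=A_t+a_{t+1}'$, $\bar z_t=\frac{A_t}{A_{t+1}'}z_t+\frac{a_{t+1}'}{A_{t+1}'}v_t$; if $t>0$, $\tilde z_{t+1}=\text{MS-Solver}(\bar z_t)$ and $\lambda_{t+1}=\gamma\|\tilde z_{t+1}-\bar z_t\|$. If $\lambda_{t+1}\le\lambda_{t+1}'$, put $a_{t+1}=a_{t+1}'$, $A_{t+1}=A_{t+1}'$, $z_{t+1}=\tilde z_{t+1}$, $\lambda_{t+2}'=\lambda_{t+1}'/\alpha$; otherwise put $\gamma_{t+1}=\lambda_{t+1}'/\lambda_{t+1}$, $a_{t+1}=\gamma_{t+1}a_{t+1}'$, $A_{t+1}=A_t+a_{t+1}$, $z_{t+1}=\frac{(1-\gamma_{t+1})A_t}{A_{t+1}}z_t+\frac{\gamma_{t+1}A_{t+1}'}{A_{t+1}}\tilde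 z_{t+1}$, $\lambda_{t+2}'=\alpha\lambda_{t+1}'$. Finally $v_{t+1}=v_t-a_{t+1}\nabla f(\tilde z_{t+1})$. Theorem. Let $\alpha>1$, $\sigma\in(0,0.99]$ and $c=\frac{1}{2(1+2\sigma)}$. There is a constant $C$, depending only on $\alpha$ and $\sigma$, such that the following holds for all $L>0$ and all integers $m\ge1$. Run A-LEN with $$\gamma=\frac Lm,\qquad M=6m(L+2\gamma),\qquad K=\Bigl\lceil\tfrac32\Bigl(m+98\sqrt{M/\gamma}\Bigr)\ln\frac{L}{c\gamma}\Bigr\rceil .$$ Then $M\le C\,mL$ and $K\le C\,m(1+\log m)$. For all $D,\varepsilon>0$ there is a number $T$ of outer iterations such that for every dimension $d$ and all $f,z_0,z^*$ as above, $f(z_{T'})-f(z^*)\le\varepsilon$ for every $T'\ge T$, and the first $T$ outer iterations use in total at most $$C\Bigl(m+m^{5/7}\bigl(LD^3/\varepsilon\bigr)^{2/7}\Bigr)(1+\log m)$$ steps; if $\varepsilon\le LD^3/m$, they use at most $$C\Bigl(m+m^{5/7}(1+\log m)\bigl(LD^3/\varepsilon\bigr)^{2/7}\Bigr)$$ steps.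 They use at most $C\bigl(1+m^{-2/7}(LD^3/\varepsilon)^{2/7}\bigr)(1+\log m)$ Hessian evaluations; up to the logarithmic factor and the additive $1$, this is $m^{-2/7}$ times the bound $O((LD^3/\varepsilon)^{2/7})$ known for the A-NPE method, which evaluates one Hessian per iteration. -/

import Mathlib

noncomputable section

namespace ALEN

variable {E : Type*} [NormedAddCommGroup E] [InnerProductSpace ℝ E] [CompleteSpace E]

/-- The Hessian `∇²f(z)`, as the derivative of the gradient map; its norm is the operator
(spectral) norm. -/
def hessian (f : E → ℝ) (z : E) : E →L[ℝ] E := fderiv ℝ (gradient f) z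

/-- `f` is twice differentiable and its Hessian is `L`-Lipschitz. -/
structure HasLipschitzHessian (f : E → ℝ) (L : ℝ) : Prop where
  differentiable : Differentiable ℝ f
  differentiable_gradient : Differentiable ℝ (gradient f)
  lipschitz : ∀ z z' : E, ‖hessian f z - hessian f z'‖ ≤ L * ‖z - z'‖

/-- Solution set of the cubic regularized Newton (CRN) equation with (possibly old) Hessian `H`:
`F(z̄) + H(z - z̄) + (M/2)‖z - z̄‖(z - z̄) = 0`. -/
def crnOracle (F : E → E) (M : ℝ) (zbar : E) (H : E →L[ℝ] E) : Set E :=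
  {z | F zbar + H (z - zbar) + (M / 2 * ‖z - zbar‖) • (z - zbar) = 0}

/-- The CRN step: a point of the solution set. (The set is a singleton whenever `M > 0` and `H` is
symmetric positive semidefinite, as in all calls below.) -/
def crn (F : E → E) (M : ℝ) (zbar : E) (H : E →L[ℝ] E) : E :=
  Classical.epsilon fun z => z ∈ crnOracle F M zbar H

/-- The second-order proximal function `g(z) = f(z) + (γ/3)‖z - z̄‖³`. -/
def proxFun (f : E → ℝ) (γ : ℝ) (zbar z : E) : ℝ := f z + γ / 3 * ‖z - zbar‖ ^ 3

/-- A point together with the number of CRN steps and of Hessian evaluations spent. -/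
structure Counted (E : Type*) where
  point : E
  steps : ℕ
  hessians : ℕ

/-- `z_{s,t}`: the lazy CRN iterates on `g`, all using the Hessian at the snapshot `z_{s,0} = z`. -/
def lazyIter (g : E → ℝ) (M : ℝ) (z : E) : ℕ → E
  | 0 => z
  | t + 1 => crn (gradient g) M (lazyIter g M z t) (hessian g z)

/-- One epoch of the sub-solver: one Hessian evaluation and `m` lazy CRN steps, followed by
averaging `z_{s,1}, …, z_{s,m}`. -/
def epoch (g : E → ℝ) (M : ℝ) (m : ℕ) (c : Counted E) : Counted E where
  point := (1 / (m : ℝ)) • ∑ t ∈ Finset.Icc 1 m, lazyIter g M c.point t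
  steps := c.steps + m
  hessians := c.hessians + 1

/-- One CRN step on `g` with regularization `L` and the Hessian at the current point. -/
def freshStep (g : E → ℝ) (L : ℝ) (c : Counted E) : Counted E where
  point := crn (gradient g) L c.point (hessian g c.point)
  steps := c.steps + 1
  hessians := c.hessians + 1

/-- The MS-solver: a CRN step at `z̄`, then `⌈K/m⌉` epochs, then a final CRN step. -/
def msSolver (f : E → ℝ) (L : ℝ) (K : ℕ) (M : ℝ) (m : ℕ) (γ : ℝ) (zbar : E) : Counted E :=
  let g : E → ℝ := proxFun f γ zbar
  let c₀ : Counted E := freshStep g L ⟨zbar, 0, 0⟩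
  let c : Counted E := (epoch g M m)^[⌈(K : ℝ) / (m : ℝ)⌉₊] c₀
  freshStep g L c

/-- State of A-LEN after `t` outer iterations: `z_t`, `v_t`, `A_t`, the guess `λ'_{t+1}`, and the
total numbers of CRN steps and Hessian evaluations so far. -/
structure State (E : Type*) where
  z : E
  v : E
  A : ℝ
  lam' : ℝ
  steps : ℕ
  hessians : ℕ

/-- A-LEN started at `z₀`, with an MS-solver `solve`: the state after a given number of outer
iterations. The solver call at `z̄_0 = z_0` made before the loop is reused (at no additional cost)
in the first iteration. -/
def run (f : E → ℝ) (solve : E → Counted E) (α γ : ℝ) (z₀ : E) : ℕ → State E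
  | 0 =>
    let c := solve z₀
    { z := z₀, v := z₀, A := 0, lam' := γ * ‖c.point - z₀‖,
      steps := c.steps, hessians := c.hessians }
  | t + 1 =>
    let s := run f solve α γ z₀ t
    let a' : ℝ := 1 / (2 * s.lam') * (1 + √(1 + 4 * s.lam' * s.A))
    let A' : ℝ := s.A + a'
    let zbar : E := (s.A / A') • s.z + (a' / A') • s.v
    let c : Counted E := if t = 0 then ⟨(solve z₀).point, 0, 0⟩ else solve zbar
    let lam : ℝ := if t = 0 then s.lam' else γ * ‖c.point - zbar‖
    if lam ≤ s.lam' then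
      { z := c.point
        v := s.v - a' • gradient f c.point
        A := A'
        lam' := 1 / α * s.lam'
        steps := s.steps + c.steps
        hessians := s.hessians + c.hessians }
    else
      let ρ : ℝ := s.lam' / lam
      let a : ℝ := ρ * a'
      let A : ℝ := s.A + a
      { z := ((1 - ρ) * s.A / A) • s.z + (ρ * A' / A) • c.point
        v := s.v - a • gradient f c.point
        A := A
        lam' := α * s.lam'
        steps := s.steps + c.steps
        hessians := s.hessians + c.hessians }

/-- The regularization parameter `M = 6m(L + 2γ)` of the MS-solver. -/
def paramM (L γ : ℝ) (m : ℕ) : ℝ := 6 * m * (L + 2 * γ)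

/-- The constant `c = 1 / (2(1 + 2σ))`. -/
def paramc (σ : ℝ) : ℝ := 1 / (2 * (1 + 2 * σ))

/-- The iteration parameter `K = ⌈(3/2)(m + 98 √(M/γ)) ln(L/(cγ))⌉` of the MS-solver. -/
def paramK (σ L γ : ℝ) (m : ℕ) : ℕ :=
  ⌈3 / 2 * (m + 98 * √(paramM L γ m / γ)) * Real.log (L / (paramc σ * γ))⌉₊

/-- A-LEN with `γ = L/m` and the above parameters of the MS-solver: the state after `T` outer
iterations. -/
def alen (f : E → ℝ) (L : ℝ) (m : ℕ) (α σ : ℝ) (z₀ : E) (T : ℕ) : State E :=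
  let γ : ℝ := L / m
  run f (msSolver f L (paramK σ L γ m) (paramM L γ m) m γ) α γ z₀ T

end ALEN

end

noncomputable section

namespace ALEN

open scoped RealInnerProductSpace

/-! ### Taylor bounds, symmetry and positivity of the Hessian -/

section Calculus

variable {E : Type*} [NormedAddCommGroup E] [InnerProductSpace ℝ E] [CompleteSpace E]
  {f : E → ℝ} {L : ℝ}

/-! The argument separates into an inner statement about the solver and an outer statement about any
solver with that property.

Inner part (`HasLipschitzHessian.msSolver_condition`). The proximal function `g` is convex, has an
`(L + 3γ)`-Lipschitz Hessian and grows at least like `γ/6 ‖z - zs‖³` around its minimizer `zs`. Put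
`R = ‖zs - z̄‖`. The first CRN step makes the gap of `g` at most `9LR³`. In a lazy epoch each step
is compared with the displacement `τ(zs - x)`; the error from the old Hessian is cubic in the drift
from the snapshot, the drift is a sum of earlier steps, and for `M` of order `mL` the cubic
regularization absorbs these errors once they are summed over the epoch. Hence the averaged point
contracts the gap by `1 - const · τm`, where `τ² = 3γ/(10M)` (`HasLipschitzHessian.epoch_le`). `K`
is so large that all epochs together gain `(2m)⁻¹⁶`, which by cubic growth brings the point within
`R/(10m)` of `zs`. The last CRN step converts this quadratically into the Monteiro–Svaiter condition
with constant `5/8`, that is, a small `‖∇g‖` relative to `γ‖z - z̄‖²`.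

Outer part (`run_gap_le`). With `E = A (f z - f zs) + ‖v - zs‖²/2`, now for `zs` a minimizer of `f`,
every iteration has `E` nonincreasing (`energy_core`), so `A` times the gap stays below `D²/2`. If
the guess `λ'` was large enough, `√A` grows by `1/(2√λ')` and `λ'` is divided by `α`; otherwise `E`
drops by a multiple of `Aλ'³/γ²` and `λ'` is multiplied by `α`. A potential argument
(`growth_of_alternating_steps`) turns this alternation into `T ≤ const · (AγD)^(2/7)`, with no
logarithm for the search over `λ'`.

Since `γ = L/m`, a gap above `ε` forces `T ≤ const · (LD³/(mε))^(2/7)` (`alen_gap_le`); multiplying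
by the cost of one call, `O(m(1 + log m))` steps and `O(1 + log m)` Hessians, gives the totals
(`alen_counts`). -/

lemma hasDerivAt_comp_line (hf : Differentiable ℝ f) (x h : E) (t : ℝ) :
    HasDerivAt (fun s : ℝ => f (x + s • h)) ⟪gradient f (x + t • h), h⟫ t := by
  have h1 : HasDerivAt (fun s : ℝ => x + s • h) h t := by
    simpa using ((hasDerivAt_id t).smul_const h).const_add x
  have h2 := (hf (x + t • h)).hasGradientAt.hasFDerivAt.comp_hasDerivAt t h1
  exact h2.congr_deriv (by simp)

lemma HasLipschitzHessian.hasFDerivAt_gradient (hf : HasLipschitzHessian f L) (z : E) :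
    HasFDerivAt (gradient f) (hessian f z) z :=
  (hf.differentiable_gradient z).hasFDerivAt

lemma HasLipschitzHessian.hasDerivAt_gradient_line (hf : HasLipschitzHessian f L) (x h : E)
    (t : ℝ) :
    HasDerivAt (fun s : ℝ => gradient f (x + s • h)) (hessian f (x + t • h) h) t := by
  have h1 : HasDerivAt (fun s : ℝ => x + s • h) h t := by
    simpa using ((hasDerivAt_id t).smul_const h).const_add x
  exact (hf.hasFDerivAt_gradient (x + t • h)).comp_hasDerivAt t h1

/-- First-order Taylor bound for the gradient. -/
lemma HasLipschitzHessian.norm_gradient_sub_le (hf : HasLipschitzHessian f L) (x h : E) :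
    ‖gradient f (x + h) - gradient f x - hessian f x h‖ ≤ L / 2 * ‖h‖ ^ 2 := by
  set φ : ℝ → E := fun t => gradient f (x + t • h) - gradient f x - t • hessian f x h with hφ
  have hd : ∀ t : ℝ, HasDerivAt φ (hessian f (x + t • h) h - hessian f x h) t := by
    intro t
    have h1 := (hf.hasDerivAt_gradient_line x h t).sub_const (gradient f x)
    have h2 := (hasDerivAt_id t).smul_const (hessian f x h)
    exact (h1.sub h2).congr_deriv (by simp)
  have hB : ∀ t : ℝ, HasDerivAt (fun t : ℝ => L / 2 * ‖h‖ ^ 2 * t ^ 2) (L * ‖h‖ ^ 2 * t) t := by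
    intro t
    have := ((hasDerivAt_id t).pow 2).const_mul (L / 2 * ‖h‖ ^ 2)
    refine this.congr_deriv ?_
    simp; ring
  have key := image_norm_le_of_norm_deriv_right_le_deriv_boundary (f := φ) (a := 0) (b := 1)
    (fun t _ => (hd t).continuousAt.continuousWithinAt)
    (fun t _ => (hd t).hasDerivWithinAt) (B := fun t : ℝ => L / 2 * ‖h‖ ^ 2 * t ^ 2)
    (by simp [hφ]) hB (by
      intro t ht
      calc ‖hessian f (x + t • h) h - hessian f x h‖
          = ‖(hessian f (x + t • h) - hessian f x) h‖ := by simp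
        _ ≤ ‖hessian f (x + t • h) - hessian f x‖ * ‖h‖ := ContinuousLinearMap.le_opNorm _ _
        _ ≤ (L * ‖x + t • h - x‖) * ‖h‖ := by gcongr; exact hf.lipschitz _ _
        _ = L * ‖h‖ ^ 2 * t := by
          rw [add_sub_cancel_left, norm_smul, Real.norm_of_nonneg ht.1]; ring)
  simpa [hφ] using key (Set.right_mem_Icc.2 zero_le_one)

/-- Second-order Taylor bound for the function. -/
lemma HasLipschitzHessian.abs_sub_le (hf : HasLipschitzHessian f L) (x h : E) :
    |f (x + h) - f x - ⟪gradient f x, h⟫ - 1 / 2 * ⟪hessian f x h, h⟫| ≤ L / 6 * ‖h‖ ^ 3 := by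
  set φ : ℝ → ℝ := fun t => f (x + t • h) - f x - t * ⟪gradient f x, h⟫ -
    t ^ 2 * (1 / 2 * ⟪hessian f x h, h⟫) with hφ
  have hd : ∀ t : ℝ, HasDerivAt φ
      ⟪gradient f (x + t • h) - gradient f x - hessian f x (t • h), h⟫ t := by
    intro t
    have h1 := (hasDerivAt_comp_line hf.differentiable x h t).sub_const (f x)
    have h2 := (hasDerivAt_id t).mul_const ⟪gradient f x, h⟫
    have h3 := ((hasDerivAt_id t).pow 2).mul_const (1 / 2 * ⟪hessian f x h, h⟫)
    refine ((h1.sub h2).sub h3).congr_deriv ?_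
    simp [inner_sub_left, inner_smul_left]
    ring
  have hB : ∀ t : ℝ, HasDerivAt (fun t : ℝ => L / 6 * ‖h‖ ^ 3 * t ^ 3)
      (L / 2 * ‖h‖ ^ 3 * t ^ 2) t := by
    intro t
    have := ((hasDerivAt_id t).pow 3).const_mul (L / 6 * ‖h‖ ^ 3)
    refine this.congr_deriv ?_
    simp; ring
  have key := image_norm_le_of_norm_deriv_right_le_deriv_boundary (f := φ) (a := 0) (b := 1)
    (fun t _ => (hd t).continuousAt.continuousWithinAt)
    (fun t _ => (hd t).hasDerivWithinAt) (B := fun t : ℝ => L / 6 * ‖h‖ ^ 3 * t ^ 3)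
    (by simp [hφ]) hB (by
      intro t ht
      calc ‖⟪gradient f (x + t • h) - gradient f x - hessian f x (t • h), h⟫‖
          ≤ ‖gradient f (x + t • h) - gradient f x - hessian f x (t • h)‖ * ‖h‖ :=
            norm_inner_le_norm _ _
        _ ≤ (L / 2 * ‖t • h‖ ^ 2) * ‖h‖ := by gcongr; exact hf.norm_gradient_sub_le _ _
        _ = L / 2 * ‖h‖ ^ 3 * t ^ 2 := by
          rw [norm_smul, Real.norm_of_nonneg ht.1]; ring)
  simpa [hφ] using key (Set.right_mem_Icc.2 zero_le_one)

lemma HasLipschitzHessian.inner_hessian_comm (hf : HasLipschitzHessian f L) (z x y : E) :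
    ⟪hessian f z x, y⟫ = ⟪hessian f z y, x⟫ := by
  have h1 : ∀ y, HasFDerivAt f (innerSL ℝ (gradient f y)) y :=
    fun y => (hf.differentiable y).hasGradientAt.hasFDerivAt
  have h2 : HasFDerivAt (fun y => innerSL ℝ (gradient f y))
      ((innerSL ℝ).comp (hessian f z)) z :=
    (innerSL ℝ).hasFDerivAt.comp z (hf.hasFDerivAt_gradient z)
  simpa using second_derivative_symmetric h1 h2 x y

/-- The gradient inequality for convex differentiable functions. -/
lemma add_inner_gradient_le (hc : ConvexOn ℝ Set.univ f) (hf : Differentiable ℝ f) (x y : E) :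
    f x + ⟪gradient f x, y - x⟫ ≤ f y := by
  have hline : ConvexOn ℝ Set.univ (fun s : ℝ => f (x + s • (y - x))) := by
    refine ⟨convex_univ, fun s _ t _ a b ha hb hab => ?_⟩
    have := hc.2 (Set.mem_univ (x + s • (y - x))) (Set.mem_univ (x + t • (y - x))) ha hb hab
    convert this using 2
    obtain rfl : b = 1 - a := by linarith
    simp only [smul_eq_mul]
    module
  have h := hline.le_slope_of_hasDerivAt (Set.mem_univ 0) (Set.mem_univ 1) one_pos
    (hasDerivAt_comp_line hf x (y - x) 0)
  rw [slope_def_field] at h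
  simp only [zero_smul, one_smul, add_zero, add_sub_cancel, sub_zero, div_one] at h
  linarith

lemma HasLipschitzHessian.inner_hessian_nonneg (hc : ConvexOn ℝ Set.univ f)
    (hf : HasLipschitzHessian f L) (z h : E) : 0 ≤ ⟪hessian f z h, h⟫ := by
  have hmono : Monotone (fun t : ℝ => ⟪gradient f (z + t • h), h⟫) := by
    intro s t hst
    rcases hst.eq_or_lt with rfl | hlt
    · rfl
    have h1 := add_inner_gradient_le hc hf.differentiable (z + s • h) (z + t • h)
    have h2 := add_inner_gradient_le hc hf.differentiable (z + t • h) (z + s • h)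
    rw [show z + t • h - (z + s • h) = (t - s) • h by module, inner_smul_right] at h1
    rw [show z + s • h - (z + t • h) = (-(t - s)) • h by module, inner_smul_right] at h2
    have : 0 < t - s := sub_pos.2 hlt
    by_contra! hcon
    nlinarith
  have hd : HasDerivAt (fun t : ℝ => ⟪gradient f (z + t • h), h⟫) ⟪hessian f z h, h⟫ 0 := by
    have := (hf.hasDerivAt_gradient_line z h 0).inner ℝ (hasDerivAt_const (0 : ℝ) h)
    simpa using this
  rw [← hd.deriv]
  exact hmono.deriv_nonneg

end Calculus

end ALEN

namespace ALEN

open scoped RealInnerProductSpace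

/-! ### The cubic `‖x‖³/3`: derivatives and uniform convexity -/

section Cubic

variable {E : Type*} [NormedAddCommGroup E] [InnerProductSpace ℝ E]

/-- The Hessian of `‖x‖³ / 3`, that is, the derivative of `x ↦ ‖x‖ x`. -/
def cubicHessian (x : E) : E →L[ℝ] E :=
  ‖x‖ • ContinuousLinearMap.id ℝ E + ‖x‖⁻¹ • (innerSL ℝ x).smulRight x

lemma cubicHessian_apply (x h : E) :
    cubicHessian x h = ‖x‖ • h + (‖x‖⁻¹ * ⟪x, h⟫) • x := by
  simp [cubicHessian, smul_smul]

lemma cubicHessian_zero : cubicHessian (0 : E) = 0 := by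
  ext h; simp [cubicHessian_apply]

/-- The rescaled vector is the projection of `x` onto the ball of radius `‖y‖`, which contains `y`,
and such projections are nonexpansive. -/
lemma norm_scaled_sub_le {x y : E} (hxy : ‖y‖ ≤ ‖x‖) :
    ‖(‖y‖ * ‖x‖⁻¹) • x - y‖ ≤ ‖x - y‖ := by
  rcases eq_or_ne ‖x‖ 0 with hx | hx
  · have : x = 0 := norm_eq_zero.1 hx
    simp [this]
  have hx0 : 0 < ‖x‖ := lt_of_le_of_ne (norm_nonneg _) hx.symm
  refine (sq_le_sq₀ (norm_nonneg _) (norm_nonneg _)).1 ?_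
  rw [norm_sub_sq_real, norm_sub_sq_real, norm_smul, inner_smul_left,
    Real.norm_of_nonneg (by positivity), mul_assoc, inv_mul_cancel₀ hx]
  have hcs := real_inner_le_norm x y
  simp only [mul_one, conj_trivial]
  set s := ⟪x, y⟫
  set a := ‖x‖
  set b := ‖y‖
  have hs : s / a ≤ b := by rw [div_le_iff₀ hx0]; linarith
  have e1 : b * a⁻¹ * s = b * (s / a) := by ring
  have e2 : s = a * (s / a) := by field_simp
  rw [e1]
  nlinarith [mul_nonneg (sub_nonneg.2 hxy) (sub_nonneg.2 hs),
    mul_nonneg (sub_nonneg.2 hxy) (sub_nonneg.2 hxy)]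

lemma norm_cubicHessian_sub_le_aux {x y : E} (hxy : ‖y‖ ≤ ‖x‖) :
    ‖cubicHessian x - cubicHessian y‖ ≤ 3 * ‖x - y‖ := by
  refine ContinuousLinearMap.opNorm_le_bound _ (by positivity) fun h => ?_
  have hw := norm_scaled_sub_le hxy
  set w := (‖y‖ * ‖x‖⁻¹) • x - y with hwd
  have hunit : ∀ u : E, ‖‖u‖⁻¹ • u‖ ≤ 1 := by
    intro u
    rw [norm_smul, norm_inv, norm_norm]
    exact inv_mul_le_one
  have hxn := hunit x
  have hyn := hunit y
  have hyy : ‖y‖ • (‖y‖⁻¹ • y) = y := by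
    rcases eq_or_ne y 0 with rfl | hy
    · simp
    · rw [smul_smul, mul_inv_cancel₀ (norm_ne_zero_iff.2 hy), one_smul]
  -- Three terms, each of norm at most `‖x - y‖ ‖h‖`; this is where the Lipschitz constant 3 comes
  -- from.
  have hid : (cubicHessian x - cubicHessian y) h = (‖x‖ - ‖y‖) • h + ⟪‖x‖⁻¹ • x, h⟫ • (x - y) +
      ⟪w, h⟫ • (‖y‖⁻¹ • y) := by
    rw [sub_apply, cubicHessian_apply, cubicHessian_apply]
    have : ⟪w, h⟫ = ‖y‖ * (‖x‖⁻¹ * ⟪x, h⟫) - ⟪y, h⟫ := by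
      rw [hwd, inner_sub_left, inner_smul_left]
      simp [mul_assoc]
    have e : (‖y‖ * (‖x‖⁻¹ * ⟪x, h⟫) - ⟪y, h⟫) • (‖y‖⁻¹ • y) =
        (‖x‖⁻¹ * ⟪x, h⟫) • (‖y‖ • (‖y‖⁻¹ • y)) - (‖y‖⁻¹ * ⟪y, h⟫) • y := by module
    rw [this, e, hyy, inner_smul_left]
    simp only [conj_trivial]
    module
  rw [hid]
  have h1 : ‖(‖x‖ - ‖y‖) • h‖ ≤ ‖x - y‖ * ‖h‖ := by
    rw [norm_smul]
    gcongr
    exact abs_norm_sub_norm_le x y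
  have h2 : ‖⟪‖x‖⁻¹ • x, h⟫ • (x - y)‖ ≤ ‖x - y‖ * ‖h‖ := by
    rw [norm_smul, mul_comm]
    gcongr
    calc ‖⟪‖x‖⁻¹ • x, h⟫‖ ≤ ‖‖x‖⁻¹ • x‖ * ‖h‖ := norm_inner_le_norm _ _
      _ ≤ 1 * ‖h‖ := by gcongr
      _ = ‖h‖ := one_mul _
  have h3 : ‖⟪w, h⟫ • (‖y‖⁻¹ • y)‖ ≤ ‖x - y‖ * ‖h‖ := by
    rw [norm_smul]
    calc ‖⟪w, h⟫‖ * ‖‖y‖⁻¹ • y‖ ≤ (‖w‖ * ‖h‖) * 1 := by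
          gcongr
          exact norm_inner_le_norm _ _
      _ ≤ ‖x - y‖ * ‖h‖ := by rw [mul_one]; gcongr
  calc _ ≤ ‖(‖x‖ - ‖y‖) • h‖ + ‖⟪‖x‖⁻¹ • x, h⟫ • (x - y)‖ + ‖⟪w, h⟫ • (‖y‖⁻¹ • y)‖ :=
        norm_add₃_le
    _ ≤ _ := by linarith

lemma norm_cubicHessian_sub_le (x y : E) :
    ‖cubicHessian x - cubicHessian y‖ ≤ 3 * ‖x - y‖ := by
  rcases le_total ‖y‖ ‖x‖ with h | h
  · exact norm_cubicHessian_sub_le_aux h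
  · rw [norm_sub_rev, norm_sub_rev x]
    exact norm_cubicHessian_sub_le_aux h

/-- A remainder bound uniform in `x`, so that differentiability at the origin needs no separate
treatment. -/
lemma norm_norm_smul_sub_le (x h : E) :
    ‖‖x + h‖ • (x + h) - ‖x‖ • x - cubicHessian x h‖ ≤ 3 / 2 * ‖h‖ ^ 2 := by
  set e := ‖x + h‖ - ‖x‖ with he
  set s := ‖x‖⁻¹ * ⟪x, h⟫ with hs
  have hid : ‖x + h‖ • (x + h) - ‖x‖ • x - cubicHessian x h = e • h + (e - s) • x := by
    rw [cubicHessian_apply, he]; module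
  have hek : |e| ≤ ‖h‖ := by
    have := abs_norm_sub_norm_le (x + h) x
    simpa [he] using this
  have hxs : ‖x‖ * s = ⟪x, h⟫ := by
    rcases eq_or_ne x 0 with rfl | hx
    · simp
    · rw [hs, ← mul_assoc, mul_inv_cancel₀ (norm_ne_zero_iff.2 hx), one_mul]
  have hsq := norm_add_sq_real x h
  have h2 : 2 * (‖x‖ * (e - s)) = ‖h‖ ^ 2 - e ^ 2 := by
    have : ‖x + h‖ = ‖x‖ + e := by rw [he]; ring
    rw [this] at hsq
    rw [mul_sub, hxs]
    nlinarith
  have he2 : e ^ 2 ≤ ‖h‖ ^ 2 := by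
    rw [← sq_abs e]; gcongr
  have h3 : ‖(e - s) • x‖ ≤ 1 / 2 * ‖h‖ ^ 2 := by
    rw [norm_smul, Real.norm_eq_abs, mul_comm, ← abs_norm x, ← abs_mul]
    rw [abs_le]
    constructor <;> nlinarith [sq_nonneg e]
  have h4 : ‖e • h‖ ≤ ‖h‖ ^ 2 := by
    rw [norm_smul, Real.norm_eq_abs, sq]; gcongr
  rw [hid]
  calc _ ≤ ‖e • h‖ + ‖(e - s) • x‖ := norm_add_le _ _
    _ ≤ _ := by linarith

lemma hasFDerivAt_norm_smul (x : E) :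
    HasFDerivAt (fun y : E => ‖y‖ • y) (cubicHessian x) x := by
  rw [hasFDerivAt_iff_isLittleO_nhds_zero]
  refine Asymptotics.IsBigO.trans_isLittleO (g := fun h : E => ‖h‖ ^ 2)
    (Asymptotics.IsBigO.of_bound (3 / 2) (Filter.Eventually.of_forall fun h => ?_)) ?_
  · simpa using norm_norm_smul_sub_le x h
  · exact Asymptotics.isLittleO_norm_pow_id one_lt_two

/-- Uniform convexity of degree three of `‖x‖³ / 3`. -/
lemma norm_cube_uniformConvex (u v : E) :
    1 / 3 * ‖v‖ ^ 3 + ‖v‖ * ⟪v, u - v⟫ + 1 / 6 * ‖u - v‖ ^ 3 ≤ 1 / 3 * ‖u‖ ^ 3 := by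
  have hk := norm_sub_sq_real u v
  have h1 : |‖u‖ - ‖v‖| ≤ ‖u - v‖ := abs_norm_sub_norm_le u v
  have h2 : ‖u - v‖ ≤ ‖u‖ + ‖v‖ := norm_sub_le u v
  rw [inner_sub_right, real_inner_self_eq_norm_sq, real_inner_comm]
  have hb := norm_nonneg v
  obtain ⟨e, he⟩ : ∃ e, ‖u‖ = ‖v‖ + e := ⟨‖u‖ - ‖v‖, by ring⟩
  have hs : ⟪u, v⟫ = (‖u‖ ^ 2 + ‖v‖ ^ 2 - ‖u - v‖ ^ 2) / 2 := by linarith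
  rw [hs]
  rw [he] at h1 h2 ⊢
  have hk0 := norm_nonneg (u - v)
  generalize ‖u - v‖ = k at *
  generalize ‖v‖ = b at *
  rw [add_sub_cancel_left, abs_le] at h1
  -- In terms of `b = ‖v‖`, `e = ‖u‖ - ‖v‖`, `k = ‖u - v‖` the claim is linear in `b`, so it
  -- suffices to insert the smallest value `b = (k - e)/2` allowed by the triangle inequality; `h4`
  -- is what then remains.
  have h3 : 0 ≤ (2 * b + e - k) * (e ^ 2 + k ^ 2) := mul_nonneg (by linarith) (by positivity)
  have h4 : 0 ≤ k ^ 3 - 3 * e * k ^ 2 + 3 * k * e ^ 2 + e ^ 3 := by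
    rcases le_total 0 e with h | h
    · have : 0 ≤ (k - e) ^ 3 := pow_nonneg (by linarith) 3
      nlinarith [pow_nonneg h 3]
    · have : 0 ≤ e ^ 2 * (k + e) := mul_nonneg (sq_nonneg e) (by linarith)
      nlinarith [mul_nonneg (neg_nonneg.2 h) (sq_nonneg k), mul_nonneg hk0 (sq_nonneg e),
        pow_nonneg hk0 3]
  nlinarith

lemma norm_cube_convex (u v : E) :
    1 / 3 * ‖v‖ ^ 3 + ‖v‖ * ⟪v, u - v⟫ ≤ 1 / 3 * ‖u‖ ^ 3 := by
  have := norm_cube_uniformConvex u v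
  have : 0 ≤ ‖u - v‖ ^ 3 := by positivity
  linarith

lemma hasFDerivAt_norm_cube (x : E) :
    HasFDerivAt (fun y : E => ‖y‖ ^ 3) ((3 * ‖x‖) • innerSL ℝ x) x := by
  have h := hasFDerivAt_norm_rpow x (p := 3) (by norm_num)
  have e : (3 : ℝ) - 2 = 1 := by norm_num
  rw [e, Real.rpow_one] at h
  refine h.congr_of_eventuallyEq (Filter.Eventually.of_forall fun y => ?_)
  simp only
  rw [← Real.rpow_natCast]; norm_num

lemma convexOn_proxFun {f : E → ℝ} {γ : ℝ} (hc : ConvexOn ℝ Set.univ f) (hγ : 0 ≤ γ) (zbar : E) :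
    ConvexOn ℝ Set.univ (proxFun f γ zbar) := by
  have h1 : ConvexOn ℝ Set.univ (fun z : E => ‖z - zbar‖) := by
    have := (convexOn_univ_norm (E := E)).translate_left (-zbar)
    simpa [sub_eq_add_neg, Function.comp_def] using this
  have h2 := (h1.pow (fun z _ => norm_nonneg _) 3).smul (show 0 ≤ γ / 3 by positivity)
  exact hc.add h2

end Cubic

/-! ### The proximal function inherits a Lipschitz Hessian and gains cubic growth -/

section Prox

variable {E : Type*} [NormedAddCommGroup E] [InnerProductSpace ℝ E] [CompleteSpace E]
  {f : E → ℝ} {L γ : ℝ}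

lemma hasGradientAt_proxFun (hf : Differentiable ℝ f) (zbar z : E) :
    HasGradientAt (proxFun f γ zbar) (gradient f z + γ • (‖z - zbar‖ • (z - zbar))) z := by
  rw [hasGradientAt_iff_hasFDerivAt]
  have h1 := (hf z).hasGradientAt.hasFDerivAt
  have h2 : HasFDerivAt (fun z : E => ‖z - zbar‖ ^ 3)
      ((3 * ‖z - zbar‖) • innerSL ℝ (z - zbar)) z :=
    HasFDerivAt.comp (f := fun z => z - zbar) z (hasFDerivAt_norm_cube (z - zbar))
      ((hasFDerivAt_id z).sub_const zbar)
  refine (h1.add (h2.const_mul (γ / 3))).congr_fderiv ?_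
  ext h
  simp
  ring

lemma gradient_proxFun (hf : Differentiable ℝ f) (zbar z : E) :
    gradient (proxFun f γ zbar) z = gradient f z + γ • (‖z - zbar‖ • (z - zbar)) :=
  (hasGradientAt_proxFun hf zbar z).gradient

lemma HasLipschitzHessian.hasFDerivAt_gradient_proxFun (hf : HasLipschitzHessian f L)
    (zbar z : E) :
    HasFDerivAt (gradient (proxFun f γ zbar)) (hessian f z + γ • cubicHessian (z - zbar)) z := by
  have h : gradient (proxFun f γ zbar) =
      fun z => gradient f z + γ • (‖z - zbar‖ • (z - zbar)) :=
    funext fun z => gradient_proxFun hf.differentiable zbar z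
  rw [h]
  have h2 : HasFDerivAt (fun z : E => ‖z - zbar‖ • (z - zbar)) (cubicHessian (z - zbar)) z :=
    HasFDerivAt.comp (g := fun y : E => ‖y‖ • y) (f := fun z => z - zbar) z
      (hasFDerivAt_norm_smul (z - zbar)) ((hasFDerivAt_id z).sub_const zbar)
  exact (hf.hasFDerivAt_gradient z).add (h2.const_smul γ)

lemma HasLipschitzHessian.hessian_proxFun (hf : HasLipschitzHessian f L) (zbar z : E) :
    hessian (proxFun f γ zbar) z = hessian f z + γ • cubicHessian (z - zbar) :=
  (hf.hasFDerivAt_gradient_proxFun zbar z).fderiv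

lemma HasLipschitzHessian.proxFun (hf : HasLipschitzHessian f L) (hγ : 0 ≤ γ) (zbar : E) :
    HasLipschitzHessian (proxFun f γ zbar) (L + 3 * γ) where
  differentiable z := (hasGradientAt_proxFun hf.differentiable zbar z).hasFDerivAt.differentiableAt
  differentiable_gradient z := (hf.hasFDerivAt_gradient_proxFun zbar z).differentiableAt
  lipschitz z z' := by
    rw [hf.hessian_proxFun, hf.hessian_proxFun, add_sub_add_comm, ← smul_sub]
    calc _ ≤ ‖hessian f z - hessian f z'‖ +
          ‖γ • (cubicHessian (z - zbar) - cubicHessian (z' - zbar))‖ := norm_add_le _ _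
      _ ≤ L * ‖z - z'‖ + γ * (3 * ‖z - z'‖) := by
        rw [norm_smul, Real.norm_of_nonneg hγ]
        gcongr
        · exact hf.lipschitz _ _
        · simpa using norm_cubicHessian_sub_le (z - zbar) (z' - zbar)
      _ = _ := by ring

/-- A minimizer of `g` is sharp: `g` grows cubically around it. -/
lemma proxFun_growth (hc : ConvexOn ℝ Set.univ f) (hf : Differentiable ℝ f) (hγ : 0 ≤ γ)
    {zbar zs : E} (hs : gradient (proxFun f γ zbar) zs = 0) (z : E) :
    γ / 6 * ‖z - zs‖ ^ 3 ≤ proxFun f γ zbar z - proxFun f γ zbar zs := by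
  have h1 := add_inner_gradient_le hc hf zs z
  have h2 := norm_cube_uniformConvex (z - zbar) (zs - zbar)
  rw [sub_sub_sub_cancel_right] at h2
  rw [gradient_proxFun hf] at hs
  have h3 : ⟪gradient f zs, z - zs⟫ = -(γ * (‖zs - zbar‖ * ⟪zs - zbar, z - zs⟫)) := by
    rw [eq_neg_of_add_eq_zero_left hs, inner_neg_left, inner_smul_left, inner_smul_left]
    simp
  have h4 := mul_le_mul_of_nonneg_left h2 hγ
  rw [h3] at h1
  unfold ALEN.proxFun
  linarith

end Prox

end ALEN

namespace ALEN

open scoped RealInnerProductSpace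
open Filter

/-! ### Existence, optimality and length of CRN steps -/

section CubicStep

variable {E : Type*} [NormedAddCommGroup E] [InnerProductSpace ℝ E]

lemma tendsto_cube_sub_linear_atTop {c : ℝ} (hc : 0 < c) (b : ℝ) :
    Tendsto (fun r : ℝ => c * r ^ 3 - b * r) atTop atTop := by
  have h1 : Tendsto (fun r : ℝ => c * r ^ 2 - b) atTop atTop :=
    tendsto_atTop_add_const_right _ _
      ((tendsto_pow_atTop two_ne_zero).const_mul_atTop hc)
  refine (tendsto_id.atTop_mul_atTop₀ h1).congr fun r => ?_
  simp only [id]; ring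

/-- The CRN equation is the stationarity condition of a continuous coercive cubic model, which
attains its minimum in a proper space. Existence is all that `crn` needs; uniqueness plays no role
below. -/
lemma crnOracle_nonempty [ProperSpace E] (F : E → E) {M : ℝ} (hM : 0 < M) (zbar : E)
    {H : E →L[ℝ] E} (hsymm : ∀ x y, ⟪H x, y⟫ = ⟪H y, x⟫) (hpos : ∀ x, 0 ≤ ⟪H x, x⟫) :
    (crnOracle F M zbar H).Nonempty := by
  set b := F zbar
  set Q : E → ℝ := fun h => ⟪b, h⟫ + 1 / 2 * ⟪H h, h⟫ + M / 6 * ‖h‖ ^ 3 with hQ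
  have hcont : Continuous Q := by fun_prop
  have htend : Tendsto Q (cocompact E) atTop := by
    refine tendsto_atTop_mono (fun h => ?_)
      ((tendsto_cube_sub_linear_atTop (show 0 < M / 6 by positivity) ‖b‖).comp
        (tendsto_norm_cocompact_atTop (E := E)))
    have h1 := neg_le_of_abs_le (abs_real_inner_le_norm b h)
    have h2 := hpos h
    simp only [Function.comp, hQ]
    linarith
  obtain ⟨h, hmin⟩ := hcont.exists_forall_le htend
  have hder : HasFDerivAt Q (innerSL ℝ (b + H h + (M / 2 * ‖h‖) • h)) h := by
    have d1 : HasFDerivAt (fun h : E => ⟪b, h⟫) (innerSL ℝ b) h := (innerSL ℝ b).hasFDerivAt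
    have d2 := (H.hasFDerivAt (x := h)).inner ℝ (hasFDerivAt_id h)
    have d3 := hasFDerivAt_norm_cube h
    refine ((d1.add (d2.const_mul (1 / 2))).add (d3.const_mul (M / 6))).congr_fderiv ?_
    ext k
    have hs := hsymm h k
    simp at hs ⊢
    rw [← hs]
    ring
  have hzero := IsLocalMin.hasFDerivAt_eq_zero (Eventually.of_forall hmin) hder
  refine ⟨zbar + h, ?_⟩
  have hv : b + H h + (M / 2 * ‖h‖) • h = 0 :=
    inner_self_eq_zero.1 (DFunLike.congr_fun hzero (b + H h + (M / 2 * ‖h‖) • h))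
  simpa [crnOracle] using hv

lemma crn_eq [ProperSpace E] (F : E → E) {M : ℝ} (hM : 0 < M) (zbar : E)
    {H : E →L[ℝ] E} (hsymm : ∀ x y, ⟪H x, y⟫ = ⟪H y, x⟫) (hpos : ∀ x, 0 ≤ ⟪H x, x⟫) :
    F zbar + H (crn F M zbar H - zbar) +
      (M / 2 * ‖crn F M zbar H - zbar‖) • (crn F M zbar H - zbar) = 0 :=
  Classical.epsilon_spec (p := fun z => z ∈ crnOracle F M zbar H)
    (crnOracle_nonempty F hM zbar hsymm hpos)

/-- A solution of the CRN equation minimizes the cubic model globally. -/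
lemma cubicModel_le {H : E →L[ℝ] E} (hsymm : ∀ x y, ⟪H x, y⟫ = ⟪H y, x⟫)
    (hpos : ∀ x, 0 ≤ ⟪H x, x⟫) {M : ℝ} (hM : 0 ≤ M) {b h : E}
    (heq : b + H h + (M / 2 * ‖h‖) • h = 0) (y : E) :
    ⟪b, h⟫ + 1 / 2 * ⟪H h, h⟫ + M / 6 * ‖h‖ ^ 3 ≤
      ⟪b, y⟫ + 1 / 2 * ⟪H y, y⟫ + M / 6 * ‖y‖ ^ 3 := by
  have h1 := hpos (y - h)
  have h2 := mul_le_mul_of_nonneg_left (norm_cube_convex y h) hM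
  have h3 : ⟪b + H h + (M / 2 * ‖h‖) • h, y - h⟫ = 0 := by rw [heq, inner_zero_left]
  have hs := hsymm h y
  simp only [map_sub, inner_sub_left, inner_sub_right, inner_add_left, inner_smul_left,
    conj_trivial] at h1 h2 h3
  linarith

/-- A CRN step is not much longer than the distance to any approximate root of the linear model. -/
lemma norm_crn_step_le {H : E →L[ℝ] E} (hpos : ∀ x, 0 ≤ ⟪H x, x⟫) {L : ℝ} (hL : 0 < L)
    {b h k : E} (heq : b + H h + (L / 2 * ‖h‖) • h = 0) (hk : ‖b + H k‖ ≤ 2 * L * ‖k‖ ^ 2) :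
    ‖h‖ ≤ 3 * ‖k‖ := by
  have h1 := hpos (h - k)
  -- Testing the equation against `h - k` and dropping `⟪H (h - k), h - k⟫ ≥ 0` leaves a scalar
  -- cubic inequality between `‖h‖` and `‖k‖`, which fails for `‖h‖ > 3‖k‖`.
  have h3 : ⟪b + H h + (L / 2 * ‖h‖) • h, h - k⟫ = 0 := by rw [heq, inner_zero_left]
  have h4 : -(2 * L * ‖k‖ ^ 2 * (‖h‖ + ‖k‖)) ≤ ⟪b + H k, h - k⟫ := by
    refine le_trans (neg_le_neg ?_) (neg_le_of_abs_le (abs_real_inner_le_norm _ _))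
    gcongr
    exact norm_sub_le _ _
  have h5 := real_inner_le_norm h k
  simp only [map_sub, inner_sub_left, inner_sub_right, inner_add_left, inner_smul_left,
    conj_trivial, real_inner_self_eq_norm_sq] at h1 h3 h4
  have hr := norm_nonneg h
  have hk0 := norm_nonneg k
  have h6 : L / 2 * ‖h‖ * (‖h‖ ^ 2 - ‖h‖ * ‖k‖) ≤ 2 * L * ‖k‖ ^ 2 * (‖h‖ + ‖k‖) := by
    have : L / 2 * ‖h‖ * (‖h‖ * ‖k‖ - ⟪h, k⟫) ≥ 0 := mul_nonneg (by positivity) (by linarith)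
    nlinarith
  have h7 : ‖h‖ * (‖h‖ ^ 2 - ‖h‖ * ‖k‖) ≤ 4 * ‖k‖ ^ 2 * (‖h‖ + ‖k‖) := by
    refine le_of_mul_le_mul_left ?_ (show 0 < L / 2 by positivity)
    linarith
  generalize ‖h‖ = r at *
  generalize ‖k‖ = q at *
  by_contra! hcon
  obtain ⟨s, hs, rfl⟩ : ∃ s, 0 < s ∧ r = 3 * q + s := ⟨r - 3 * q, by linarith, by ring⟩
  have hp : 0 < s ^ 3 := by positivity
  nlinarith [mul_nonneg hk0 (sq_nonneg s), mul_nonneg hs.le (sq_nonneg q), pow_nonneg hk0 3]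

end CubicStep

/-! ### Gradient after a CRN step, and existence of the proximal point -/

section Newton

variable {E : Type*} [NormedAddCommGroup E] [InnerProductSpace ℝ E] [CompleteSpace E]
  {g : E → ℝ} {N : ℝ}

lemma HasLipschitzHessian.norm_gradient_crn_le (hg : HasLipschitzHessian g N) {M : ℝ}
    (hM : 0 ≤ M) {x z : E}
    (heq : gradient g x + hessian g x (z - x) + (M / 2 * ‖z - x‖) • (z - x) = 0) :
    ‖gradient g z‖ ≤ (N + M) / 2 * ‖z - x‖ ^ 2 := by
  have h1 := hg.norm_gradient_sub_le x (z - x)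
  rw [add_sub_cancel] at h1
  have h2 : gradient g z = (gradient g z - gradient g x - hessian g x (z - x)) -
      (M / 2 * ‖z - x‖) • (z - x) := by
    rw [eq_sub_iff_add_eq, ← sub_eq_zero, ← heq]; abel
  rw [h2]
  calc _ ≤ N / 2 * ‖z - x‖ ^ 2 + ‖(M / 2 * ‖z - x‖) • (z - x)‖ :=
        (norm_sub_le _ _).trans (by gcongr)
    _ = _ := by rw [norm_smul, Real.norm_of_nonneg (by positivity)]; ring

lemma exists_gradient_proxFun_eq_zero [ProperSpace E] {f : E → ℝ} {γ : ℝ} (hγ : 0 < γ)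
    (hf : Differentiable ℝ f) {c : ℝ} (hc : ∀ z, c ≤ f z) (zbar : E) :
    ∃ zs, gradient (proxFun f γ zbar) zs = 0 := by
  have hd : Differentiable ℝ (proxFun f γ zbar) := fun z =>
    (hasGradientAt_proxFun hf zbar z).hasFDerivAt.differentiableAt
  have hcont : Continuous (fun h => proxFun f γ zbar (zbar + h)) :=
    hd.continuous.comp (by fun_prop)
  have htend : Tendsto (fun h => proxFun f γ zbar (zbar + h)) (cocompact E) atTop := by
    refine tendsto_atTop_mono (fun h => ?_)
      (tendsto_atTop_add_const_left _ c
        ((tendsto_cube_sub_linear_atTop (show 0 < γ / 3 by positivity) 0).comp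
          (tendsto_norm_cocompact_atTop (E := E))))
    simp only [Function.comp, proxFun, add_sub_cancel_left]
    linarith [hc (zbar + h)]
  obtain ⟨h, hmin⟩ := hcont.exists_forall_le htend
  refine ⟨zbar + h, ?_⟩
  have hm : IsLocalMin (proxFun f γ zbar) (zbar + h) :=
    Eventually.of_forall fun z => by simpa using hmin (z - zbar)
  rw [gradient, hm.fderiv_eq_zero, map_zero]

end Newton

end ALEN

namespace ALEN

open scoped RealInnerProductSpace
open Finset

/-! ### Contraction of the gap over one lazy epoch -/

section LazyEpoch

variable {E : Type*} [NormedAddCommGroup E] [InnerProductSpace ℝ E] [CompleteSpace E]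
  {g : E → ℝ} {N : ℝ}

/-- One CRN step with the Hessian taken at `w`, compared with an arbitrary displacement `k`. -/
lemma HasLipschitzHessian.lazy_step_le (hc : ConvexOn ℝ Set.univ g)
    (hg : HasLipschitzHessian g N) {M : ℝ} (hM : 0 ≤ M) {w x h : E}
    (heq : gradient g x + hessian g w h + (M / 2 * ‖h‖) • h = 0) (k : E) :
    g (x + h) ≤ g (x + k) + N / 2 * ‖x - w‖ * (‖h‖ ^ 2 + ‖k‖ ^ 2) + (N + M) / 6 * ‖k‖ ^ 3 -
      (M - N) / 6 * ‖h‖ ^ 3 := by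
  have h1 := (abs_le.1 (hg.abs_sub_le x h)).2
  have h2 := (abs_le.1 (hg.abs_sub_le x k)).1
  have h3 := cubicModel_le (hg.inner_hessian_comm w) (hg.inner_hessian_nonneg hc w) hM heq k
  have h4 : ∀ v : E, |⟪hessian g x v, v⟫ - ⟪hessian g w v, v⟫| ≤ N * ‖x - w‖ * ‖v‖ ^ 2 := by
    intro v
    rw [← inner_sub_left, ← sub_apply]
    calc _ ≤ ‖(hessian g x - hessian g w) v‖ * ‖v‖ := abs_real_inner_le_norm _ _
      _ ≤ (‖hessian g x - hessian g w‖ * ‖v‖) * ‖v‖ := by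
        gcongr; exact ContinuousLinearMap.le_opNorm _ _
      _ ≤ ((N * ‖x - w‖) * ‖v‖) * ‖v‖ := by gcongr; exact hg.lipschitz _ _
      _ = _ := by ring
  have h5 := (abs_le.1 (h4 h)).2
  have h6 := (abs_le.1 (h4 k)).1
  linarith

/-- Splits the stale-Hessian error `a r²` into a drift term and a step term; with `μ = m` the drift
term carries the weight `1/m²` that compensates the factor `m³` of `sum_norm_sub_cube_le` up to one
power of `m`. -/
lemma young_cube {a r μ : ℝ} (ha : 0 ≤ a) (hr : 0 ≤ r) (hμ : 0 < μ) :
    1 / 2 * (a * r ^ 2) ≤ a ^ 3 / (6 * μ ^ 2) + μ / 3 * r ^ 3 := by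
  have h : 0 ≤ (a - μ * r) ^ 2 * (a + 2 * (μ * r)) := by positivity
  have e : a ^ 3 / (6 * μ ^ 2) + μ / 3 * r ^ 3 - 1 / 2 * (a * r ^ 2) =
      (a - μ * r) ^ 2 * (a + 2 * (μ * r)) / (6 * μ ^ 2) := by
    field_simp; ring
  have : 0 ≤ (a - μ * r) ^ 2 * (a + 2 * (μ * r)) / (6 * μ ^ 2) := by positivity
  linarith

lemma sum_range_sq_le (j : ℕ) : ∑ t ∈ range j, (t : ℝ) ^ 2 ≤ (j : ℝ) ^ 3 / 3 := by
  induction j with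
  | zero => simp
  | succ j ih =>
    rw [sum_range_succ]
    push_cast
    nlinarith [(Nat.cast_nonneg j : (0 : ℝ) ≤ j)]

/-- Drift from the snapshot is controlled by the step lengths. -/
lemma sum_norm_sub_cube_le {V : Type*} [SeminormedAddCommGroup V] (x : ℕ → V) (j : ℕ) :
    ∑ t ∈ range j, ‖x t - x 0‖ ^ 3 ≤ (j : ℝ) ^ 3 / 3 * ∑ t ∈ range j, ‖x (t + 1) - x t‖ ^ 3 := by
  have h1 : ∀ t ∈ range j, ‖x t - x 0‖ ^ 3 ≤
      (t : ℝ) ^ 2 * ∑ i ∈ range j, ‖x (i + 1) - x i‖ ^ 3 := by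
    intro t ht
    have e : x t - x 0 = ∑ i ∈ range t, (x (i + 1) - x i) := (sum_range_sub x t).symm
    calc ‖x t - x 0‖ ^ 3 ≤ (∑ i ∈ range t, ‖x (i + 1) - x i‖) ^ 3 := by
          rw [e]; gcongr; exact norm_sum_le _ _
      _ ≤ (t : ℝ) ^ 2 * ∑ i ∈ range t, ‖x (i + 1) - x i‖ ^ 3 := by
          simpa using pow_sum_le_card_mul_sum_pow (s := range t)
            (f := fun i => ‖x (i + 1) - x i‖) (fun _ _ => norm_nonneg _) 2
      _ ≤ _ := by
          gcongr
          exact (mem_range.1 ht).le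
  calc _ ≤ ∑ t ∈ range j, (t : ℝ) ^ 2 * ∑ i ∈ range j, ‖x (i + 1) - x i‖ ^ 3 := sum_le_sum h1
    _ = (∑ t ∈ range j, (t : ℝ) ^ 2) * ∑ i ∈ range j, ‖x (i + 1) - x i‖ ^ 3 := by rw [sum_mul]
    _ ≤ _ := by gcongr; exact sum_range_sq_le j

/-- The decay of the function values over the first `j` steps of an epoch. -/
lemma HasLipschitzHessian.sum_lazy_le (hc : ConvexOn ℝ Set.univ g)
    (hg : HasLipschitzHessian g N) (hN : 0 ≤ N) {M γ τ : ℝ} (hM : 0 < M) {m : ℕ}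
    (hm : 1 ≤ m) (hMN : 9 * (m * N) ≤ 2 * M) {zs : E}
    (hgrow : ∀ z, γ / 6 * ‖z - zs‖ ^ 3 ≤ g z - g zs) (hτ : 0 ≤ τ) (hτ1 : τ ≤ 1)
    (hτ2 : 10 * M * τ ^ 2 = 3 * γ) {x : ℕ → E}
    (heq : ∀ t, gradient g (x t) + hessian g (x 0) (x (t + 1) - x t) +
      (M / 2 * ‖x (t + 1) - x t‖) • (x (t + 1) - x t) = 0) {j : ℕ} (hj : j ≤ m) :
    ∑ t ∈ range j, (g (x (t + 1)) - g zs) ≤ (1 - τ / 2) * ∑ t ∈ range j, (g (x t) - g zs) := by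
  have hm0 : (1 : ℝ) ≤ m := by exact_mod_cast hm
  have hstep : ∀ t ∈ range j, g (x (t + 1)) - g zs ≤ (1 - τ / 2) * (g (x t) - g zs) +
      (N / (3 * (m : ℝ) ^ 2) * ‖x t - x 0‖ ^ 3 +
        (N * (m / 3) - (M - N) / 6) * ‖x (t + 1) - x t‖ ^ 3) := by
    intro t _
    -- The comparison displacement goes a fraction `τ` of the way to `zs`: convexity gains `τ` times
    -- the gap, and `τ` is tuned so that the cubic errors cost only half of this.
    have h1 := hg.lazy_step_le hc hM.le (heq t) (τ • (zs - x t))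
    rw [add_sub_cancel, norm_smul, Real.norm_of_nonneg hτ, norm_sub_rev zs] at h1
    have hconv : g (x t + τ • (zs - x t)) ≤ (1 - τ) * g (x t) + τ * g zs := by
      have := hc.2 (Set.mem_univ (x t)) (Set.mem_univ zs) (sub_nonneg.2 hτ1) hτ (by ring)
      rw [show (1 - τ) • x t + τ • zs = x t + τ • (zs - x t) by module] at this
      simpa using this
    have hgr := hgrow (x t)
    set r := ‖x (t + 1) - x t‖
    set a := ‖x t - x 0‖
    set R := ‖x t - zs‖
    have hR : 0 ≤ R := norm_nonneg _
    have y1 := mul_le_mul_of_nonneg_left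
      (young_cube (norm_nonneg (x t - x 0)) (norm_nonneg (x (t + 1) - x t))
        (zero_lt_one.trans_le hm0)) hN
    have y2 := mul_le_mul_of_nonneg_left
      (young_cube (norm_nonneg (x t - x 0)) (mul_nonneg hτ hR)
        (zero_lt_one.trans_le hm0)) hN
    have e1 : N * (a ^ 3 / (6 * (m : ℝ) ^ 2)) = 1 / 2 * (N / (3 * (m : ℝ) ^ 2) * a ^ 3) := by
      field_simp; ring
    rw [mul_add, e1] at y1 y2
    have hρ : N * (m / 3 * (τ * R) ^ 3) + (N + M) / 6 * (τ * R) ^ 3 ≤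
        τ / 2 * (g (x t) - g zs) := by
      have hco : N * (m / 3) + (N + M) / 6 ≤ 5 * M / 18 := by nlinarith
      calc _ = (N * (m / 3) + (N + M) / 6) * (τ * R) ^ 3 := by ring
        _ ≤ 5 * M / 18 * (τ * R) ^ 3 := by gcongr
        _ = τ / 36 * (10 * M * τ ^ 2) * R ^ 3 := by ring
        _ = τ / 2 * (γ / 6 * R ^ 3) := by rw [hτ2]; ring
        _ ≤ _ := by gcongr
    nlinarith
  have hsum := sum_le_sum hstep
  rw [sum_add_distrib, sum_add_distrib, ← mul_sum, ← mul_sum, ← mul_sum] at hsum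
  have hdrift := sum_norm_sub_cube_le x j
  set Sr := ∑ t ∈ range j, ‖x (t + 1) - x t‖ ^ 3
  have hSr : 0 ≤ Sr := sum_nonneg fun _ _ => by positivity
  have hj' : (j : ℝ) ^ 3 ≤ (m : ℝ) ^ 3 := by gcongr
  have h1 : N / (3 * (m : ℝ) ^ 2) * ∑ t ∈ range j, ‖x t - x 0‖ ^ 3 ≤ N * m / 9 * Sr := by
    calc _ ≤ N / (3 * (m : ℝ) ^ 2) * ((m : ℝ) ^ 3 / 3 * Sr) := by
          gcongr; exact hdrift.trans (by gcongr)
      _ = _ := by field_simp; ring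
  -- The total coefficient of the cubed step lengths is nonpositive because `M` dominates `mN`; the
  -- drift is thus paid by the regularization. This works only for prefix sums, not step by step.
  have h2 : (N * m / 9 + (N * (m / 3) - (M - N) / 6)) * Sr ≤ 0 :=
    mul_nonpos_of_nonpos_of_nonneg (by nlinarith) hSr
  linarith

/-- A discrete Grönwall estimate for sums of a nonnegative sequence. -/
lemma sum_le_of_shifted_sum_le {δ : ℕ → ℝ} {p : ℝ} (hδ : 0 ≤ δ 0) (hp : 0 ≤ p) {m : ℕ}
    (hpm : p * m ≤ 1 / 8)
    (h : ∀ j ≤ m, ∑ t ∈ range j, δ (t + 1) ≤ (1 - p) * ∑ t ∈ range j, δ t) :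
    ∀ j ≤ m, ∑ t ∈ range j, δ (t + 1) ≤ (j - 47 / 100 * p * (j * (j + 1))) * δ 0 := by
  intro j
  induction j with
  | zero => simp
  | succ j ih =>
    intro hj
    have h1 := h (j + 1) hj
    have h2 := ih (by omega)
    rw [sum_range_succ' δ j] at h1
    have hjm : (j : ℝ) + 1 ≤ m := by exact_mod_cast hj
    have hm1 : (1 : ℝ) ≤ m := by linarith [(Nat.cast_nonneg j : (0 : ℝ) ≤ j)]
    have hj0 : (0 : ℝ) ≤ j := Nat.cast_nonneg j
    have hpj : p * j ≤ 1 / 8 := by nlinarith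
    have hp1 : 0 ≤ 1 - p := by nlinarith
    refine h1.trans ((mul_le_mul_of_nonneg_left (add_le_add_left h2 (δ 0)) hp1).trans ?_)
    push_cast
    -- The recursion `S_{j+1} ≤ (1 - p)(S_j + δ 0)` has first-order solution `j - p j(j + 1)/2`.
    -- Lowering `1/2` to `47/100` leaves slack `6/100`, which covers the second-order term as
    -- `47/100 · 1/8 < 6/100`.
    have key : (1 - p) * ((j - 47 / 100 * p * (j * (j + 1))) + 1) ≤
        (j + 1) - 47 / 100 * p * ((j + 1) * ((j + 1) + 1)) := by
      have : 0 ≤ p * (j + 1) * (6 / 100 - 47 / 100 * (p * j)) := by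
        apply mul_nonneg (by positivity); linarith
      nlinarith
    calc _ = (1 - p) * ((j - 47 / 100 * p * (j * (j + 1))) + 1) * δ 0 := by ring
      _ ≤ _ := by gcongr

/-- One epoch of lazy CRN steps contracts the function gap. -/
lemma HasLipschitzHessian.epoch_le [ProperSpace E] (hc : ConvexOn ℝ Set.univ g)
    (hg : HasLipschitzHessian g N) (hN : 0 ≤ N) {M γ : ℝ} (hM : 0 < M) (hγ : 0 < γ) {m : ℕ}
    (hm : 1 ≤ m) (hMN : 9 * (m * N) ≤ 2 * M) (hMγ : 6 * m ^ 2 * γ ≤ M) {zs : E}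
    (hgrow : ∀ z, γ / 6 * ‖z - zs‖ ^ 3 ≤ g z - g zs) (c : Counted E) :
    g (epoch g M m c).point - g zs ≤
      (1 - 47 / 200 * √(3 * γ / (10 * M)) * m) * (g c.point - g zs) := by
  set τ := √(3 * γ / (10 * M)) with hτd
  have hτ : 0 ≤ τ := Real.sqrt_nonneg _
  have hτsq : τ ^ 2 = 3 * γ / (10 * M) := Real.sq_sqrt (by positivity)
  have hτ2 : 10 * M * τ ^ 2 = 3 * γ := by rw [hτsq]; field_simp
  have hm0 : (1 : ℝ) ≤ m := by exact_mod_cast hm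
  have hτm : τ / 2 * m ≤ 1 / 8 := by
    have h1 : (τ * m) ^ 2 ≤ (1 / 4) ^ 2 := by
      rw [mul_pow, hτsq, div_mul_eq_mul_div, div_le_iff₀ (by positivity)]
      nlinarith
    have := (le_abs_self _).trans (abs_le_of_sq_le_sq h1 (by norm_num))
    linarith
  have hτ1 : τ ≤ 1 := by nlinarith
  have hgap : ∀ z, 0 ≤ g z - g zs := fun z => le_trans (by positivity) (hgrow z)
  set x := lazyIter g M c.point with hx
  have heq : ∀ t, gradient g (x t) + hessian g (x 0) (x (t + 1) - x t) +
      (M / 2 * ‖x (t + 1) - x t‖) • (x (t + 1) - x t) = 0 := fun t =>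
    crn_eq (gradient g) hM (x t) (hg.inner_hessian_comm c.point)
      (hg.inner_hessian_nonneg hc c.point)
  have hB := sum_le_of_shifted_sum_le (δ := fun t => g (x t) - g zs) (p := τ / 2)
    (hgap _) (by positivity) hτm
    (fun j hj => hg.sum_lazy_le hc hN hM hm hMN hgrow hτ hτ1 hτ2 heq hj) m le_rfl
  have hpt : (epoch g M m c).point = ∑ t ∈ range m, (1 / (m : ℝ)) • x (t + 1) := by
    rw [epoch, ← smul_sum, range_eq_Ico, sum_Ico_add' (fun t => x t) 0 m 1]
    rfl
  have hjen : g (epoch g M m c).point ≤ ∑ t ∈ range m, (1 / (m : ℝ)) * g (x (t + 1)) := by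
    rw [hpt]
    refine hc.map_sum_le (w := fun _ => 1 / (m : ℝ)) (fun _ _ => by positivity) ?_
      (fun _ _ => Set.mem_univ _)
    simp only [sum_const, card_range, nsmul_eq_mul]
    field_simp
  have h0 : x 0 = c.point := rfl
  rw [← mul_sum] at hjen
  simp only [sum_sub_distrib, sum_const, card_range, nsmul_eq_mul, h0] at hB
  have hfin : g (epoch g M m c).point - g zs ≤
      1 / (m : ℝ) * ((m - 47 / 100 * (τ / 2) * (m * (m + 1))) * (g c.point - g zs)) := by
    calc _ ≤ 1 / (m : ℝ) * ∑ t ∈ range m, g (x (t + 1)) - g zs := by linarith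
      _ = 1 / (m : ℝ) * (∑ t ∈ range m, g (x (t + 1)) - m * g zs) := by field_simp
      _ ≤ _ := by gcongr
  refine hfin.trans ?_
  rw [← mul_assoc]
  refine mul_le_mul_of_nonneg_right ?_ (hgap _)
  have : 1 / (m : ℝ) * (m - 47 / 100 * (τ / 2) * (m * (m + 1))) =
    1 - 47 / 200 * τ * (m + 1) := by field_simp; ring
  rw [this]
  nlinarith

end LazyEpoch

end ALEN

namespace ALEN

open scoped RealInnerProductSpace
open Finset

/-! ### The solver reaches the Monteiro–Svaiter condition -/

section Solver

lemma paramM_pos {L : ℝ} {m : ℕ} (hL : 0 < L) (hm : 1 ≤ m) : 0 < paramM L (L / m) m := by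
  have hm0 : (0 : ℝ) < m := by exact_mod_cast hm
  unfold paramM
  positivity

lemma paramM_div {L : ℝ} {m : ℕ} (hL : 0 < L) (hm : 1 ≤ m) :
    paramM L (L / m) m / (L / m) = 6 * m * (m + 2) := by
  have hm0 : (0 : ℝ) < m := by exact_mod_cast hm
  unfold paramM
  field_simp

lemma log_two_mul_le {L σ : ℝ} {m : ℕ} (hL : 0 < L) (hm : 1 ≤ m) (hσ : 0 < σ) :
    Real.log (2 * m) ≤ Real.log (L / (paramc σ * (L / m))) := by
  have hm0 : (0 : ℝ) < m := by exact_mod_cast hm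
  have e : L / (paramc σ * (L / m)) = 2 * m * (1 + 2 * σ) := by
    unfold paramc
    field_simp
  rw [e]
  exact Real.log_le_log (by positivity) (le_mul_of_one_le_right (by positivity) (by linarith))

/-- The parameter `K` is large enough for the epochs to contract the gap polynomially in `m`. -/
lemma contraction_pow_le {L σ : ℝ} {m : ℕ} (hL : 0 < L) (hm : 1 ≤ m) (hσ : 0 < σ) :
    (1 - 47 / 200 * √(3 * (L / m) / (10 * paramM L (L / m) m)) * m) ^
      ⌈(paramK σ L (L / m) m : ℝ) / (m : ℝ)⌉₊ ≤ ((2 * (m : ℝ)) ^ 16)⁻¹ := by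
  have hm1 : (1 : ℝ) ≤ m := by exact_mod_cast hm
  have hm0 : (0 : ℝ) < m := by linarith
  set W := √(paramM L (L / m) m / (L / m)) with hW
  set τ := √(3 * (L / m) / (10 * paramM L (L / m) m)) with hτ
  set S := ⌈(paramK σ L (L / m) m : ℝ) / (m : ℝ)⌉₊ with hS
  have hMpos := paramM_pos hL hm
  have hτ0 : 0 ≤ τ := Real.sqrt_nonneg _
  -- `τW = √(3/10)` exactly, so the contraction rate and the factor `√(M/γ)` in `K` cancel. The
  -- resulting exponent is about `18.9`, of which `16` is kept.
  have hτW : 547 / 1000 ≤ τ * W := by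
    rw [hτ, hW, ← Real.sqrt_mul (by positivity)]
    apply Real.le_sqrt_of_sq_le
    have : 3 * (L / m) / (10 * paramM L (L / m) m) * (paramM L (L / m) m / (L / m)) = 3 / 10 := by
      field_simp
    rw [this]; norm_num
  have hτm : τ * m ≤ 1 := by
    have h1 : (τ * m) ^ 2 ≤ 1 ^ 2 := by
      rw [mul_pow, hτ, Real.sq_sqrt (by positivity)]
      have e : 3 * (L / m) / (10 * paramM L (L / m) m) = 3 / (10 * (6 * m * (m + 2))) := by
        rw [← paramM_div hL hm]; field_simp
      rw [e, div_mul_eq_mul_div, div_le_iff₀ (by positivity)]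
      nlinarith
    exact (le_abs_self _).trans (abs_le_of_sq_le_sq h1 (by norm_num))
  have hlog0 : 0 ≤ Real.log (2 * m) := Real.log_nonneg (by linarith)
  have hlog := log_two_mul_le hL hm hσ
  have hSm : 147 * W * Real.log (2 * m) ≤ S * m := by
    have h1 : (paramK σ L (L / m) m : ℝ) ≤ S * m := by
      rw [← div_le_iff₀ hm0]; exact Nat.le_ceil _
    have h2 : 3 / 2 * (m + 98 * W) * Real.log (L / (paramc σ * (L / m))) ≤
        (paramK σ L (L / m) m : ℝ) := Nat.le_ceil _
    have h3 : 147 * W * Real.log (2 * m) ≤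
        3 / 2 * (m + 98 * W) * Real.log (L / (paramc σ * (L / m))) := by
      have hW0 : 0 ≤ W := Real.sqrt_nonneg _
      calc _ ≤ 147 * W * Real.log (L / (paramc σ * (L / m))) := by gcongr
        _ = 3 / 2 * (98 * W) * Real.log (L / (paramc σ * (L / m))) := by ring
        _ ≤ _ := by gcongr <;> linarith
    linarith
  calc (1 - 47 / 200 * τ * m) ^ S ≤ (Real.exp (-(47 / 200 * τ * m))) ^ S := by
        refine pow_le_pow_left₀ (by linarith) (Real.one_sub_le_exp_neg _) S
    _ = Real.exp (-(47 / 200 * τ * (S * m))) := by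
        rw [← Real.exp_nat_mul]; congr 1; ring
    _ ≤ Real.exp (-(16 * Real.log (2 * m))) := by
        apply Real.exp_le_exp.2
        apply neg_le_neg
        calc 16 * Real.log (2 * m) ≤ 47 / 200 * 147 * (547 / 1000) * Real.log (2 * m) := by
              gcongr; norm_num
          _ ≤ 47 / 200 * 147 * (τ * W) * Real.log (2 * m) := by gcongr
          _ = 47 / 200 * τ * (147 * W * Real.log (2 * m)) := by ring
          _ ≤ _ := by gcongr
    _ = ((2 * (m : ℝ)) ^ 16)⁻¹ := by
        rw [Real.exp_neg]
        congr 1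
        rw [show (16 : ℝ) = ((16 : ℕ) : ℝ) by norm_num, Real.exp_nat_mul,
          Real.exp_log (by positivity)]

variable {E : Type*} [NormedAddCommGroup E] [InnerProductSpace ℝ E] [CompleteSpace E]

lemma iterate_epoch_steps (g : E → ℝ) (M : ℝ) (m S : ℕ) (c : Counted E) :
    ((epoch g M m)^[S] c).steps = c.steps + S * m ∧
      ((epoch g M m)^[S] c).hessians = c.hessians + S := by
  induction S with
  | zero => simp
  | succ S ih =>
    rw [Function.iterate_succ_apply']
    simp only [epoch, ih]
    constructor <;> ring

lemma msSolver_steps (f : E → ℝ) (L : ℝ) (K : ℕ) (M : ℝ) (m : ℕ) (γ : ℝ) (zbar : E) :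
    (msSolver f L K M m γ zbar).steps = ⌈(K : ℝ) / (m : ℝ)⌉₊ * m + 2 ∧
      (msSolver f L K M m γ zbar).hessians = ⌈(K : ℝ) / (m : ℝ)⌉₊ + 2 := by
  simp only [msSolver, freshStep, iterate_epoch_steps]
  constructor <;> ring

/-- The first CRN step of the solver makes the gap cubic in the distance to the prox point. -/
lemma HasLipschitzHessian.proxFun_freshStep_sub_le [ProperSpace E] {f : E → ℝ} {L γ : ℝ}
    (hc : ConvexOn ℝ Set.univ f) (hf : HasLipschitzHessian f L) (hL : 0 < L) (hγ : 0 < γ)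
    (hγL : γ ≤ L) {zbar zs : E} (hzs : gradient (ALEN.proxFun f γ zbar) zs = 0) :
    ALEN.proxFun f γ zbar
        (crn (gradient (ALEN.proxFun f γ zbar)) L zbar (hessian (ALEN.proxFun f γ zbar) zbar)) -
      ALEN.proxFun f γ zbar zs ≤ 9 * L * ‖zs - zbar‖ ^ 3 := by
  -- The cubic term has zero gradient and Hessian at its centre, so the first step is a CRN step on
  -- `f` itself and is analysed there.
  have hgrad : gradient (ALEN.proxFun f γ zbar) zbar = gradient f zbar := by
    rw [gradient_proxFun hf.differentiable]; simp
  have hhess : hessian (ALEN.proxFun f γ zbar) zbar = hessian f zbar := by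
    rw [hf.hessian_proxFun, sub_self, cubicHessian_zero]; simp
  have heq := crn_eq (gradient (ALEN.proxFun f γ zbar)) hL zbar
    (H := hessian (ALEN.proxFun f γ zbar) zbar)
    (by rw [hhess]; exact hf.inner_hessian_comm zbar)
    (by rw [hhess]; exact hf.inner_hessian_nonneg hc zbar)
  set z0 := crn (gradient (ALEN.proxFun f γ zbar)) L zbar (hessian (ALEN.proxFun f γ zbar) zbar)
  rw [hgrad, hhess] at heq
  have hlen : ‖z0 - zbar‖ ≤ 3 * ‖zs - zbar‖ := by
    refine norm_crn_step_le (hf.inner_hessian_nonneg hc zbar) hL heq ?_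
    have h1 := hf.norm_gradient_sub_le zbar (zs - zbar)
    rw [add_sub_cancel] at h1
    rw [gradient_proxFun hf.differentiable] at hzs
    have h2 : ‖gradient f zs‖ = γ * ‖zs - zbar‖ ^ 2 := by
      rw [eq_neg_of_add_eq_zero_left hzs, norm_neg, norm_smul, norm_smul, norm_norm,
        Real.norm_of_nonneg hγ.le]
      ring
    calc ‖gradient f zbar + hessian f zbar (zs - zbar)‖
        = ‖gradient f zs - (gradient f zs - gradient f zbar - hessian f zbar (zs - zbar))‖ := by
          congr 1; abel
      _ ≤ γ * ‖zs - zbar‖ ^ 2 + L / 2 * ‖zs - zbar‖ ^ 2 :=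
          (norm_sub_le _ _).trans (add_le_add h2.le h1)
      _ ≤ _ := by nlinarith [sq_nonneg ‖zs - zbar‖]
  have hstep := hf.lazy_step_le hc hL.le heq (zs - zbar)
  rw [add_sub_cancel, add_sub_cancel] at hstep
  simp only [sub_self, norm_zero, mul_zero, zero_mul, zero_div, add_zero, sub_zero] at hstep
  have h3 : ‖z0 - zbar‖ ^ 3 ≤ (3 * ‖zs - zbar‖) ^ 3 := by gcongr
  have h4 : γ / 3 * ‖z0 - zbar‖ ^ 3 ≤ γ / 3 * (3 * ‖zs - zbar‖) ^ 3 := by gcongr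
  have h5 : γ * ‖zs - zbar‖ ^ 3 ≤ L * ‖zs - zbar‖ ^ 3 := by gcongr
  simp only [ALEN.proxFun]
  nlinarith

lemma HasLipschitzHessian.iterate_epoch_le [ProperSpace E] {g : E → ℝ} {N : ℝ}
    (hc : ConvexOn ℝ Set.univ g)
    (hg : HasLipschitzHessian g N) (hN : 0 ≤ N) {M γ : ℝ} (hM : 0 < M) (hγ : 0 < γ) {m : ℕ}
    (hm : 1 ≤ m) (hMN : 9 * (m * N) ≤ 2 * M) (hMγ : 6 * m ^ 2 * γ ≤ M) {zs : E}
    (hgrow : ∀ z, γ / 6 * ‖z - zs‖ ^ 3 ≤ g z - g zs)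
    (hq : 0 ≤ 1 - 47 / 200 * √(3 * γ / (10 * M)) * m) (c : Counted E) (S : ℕ) :
    g ((epoch g M m)^[S] c).point - g zs ≤
      (1 - 47 / 200 * √(3 * γ / (10 * M)) * m) ^ S * (g c.point - g zs) := by
  induction S with
  | zero => simp
  | succ S ih =>
    rw [Function.iterate_succ_apply', pow_succ', mul_assoc]
    exact (hg.epoch_le hc hN hM hγ hm hMN hMγ hgrow _).trans (mul_le_mul_of_nonneg_left ih hq)

/-- The output of the solver satisfies the Monteiro–Svaiter condition. -/
theorem HasLipschitzHessian.msSolver_condition [ProperSpace E] {f : E → ℝ} {L σ lb : ℝ} {m : ℕ}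
    (hc : ConvexOn ℝ Set.univ f) (hf : HasLipschitzHessian f L) (hL : 0 < L) (hm : 1 ≤ m)
    (hσ : 0 < σ) (hlb : ∀ z, lb ≤ f z) (zbar : E) {z : E}
    (hz : z = (msSolver f L (paramK σ L (L / m) m) (paramM L (L / m) m) m (L / m) zbar).point) :
    ‖gradient f z + (L / m) • (‖z - zbar‖ • (z - zbar))‖ ≤ 5 / 8 * (L / m * ‖z - zbar‖ ^ 2) := by
  have hm1 : (1 : ℝ) ≤ m := by exact_mod_cast hm
  have hm0 : (0 : ℝ) < m := by linarith
  set γ := L / (m : ℝ) with hγd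
  have hγ : 0 < γ := by positivity
  have hγL : γ ≤ L := div_le_self hL.le hm1
  have hγm : γ * m = L := by rw [hγd]; field_simp
  set M := paramM L γ m with hM
  have hMpos : 0 < M := paramM_pos hL hm
  set K := paramK σ L γ m with hK
  obtain ⟨zs, hzs⟩ := exists_gradient_proxFun_eq_zero hγ hf.differentiable hlb zbar
  have hgrow := proxFun_growth hc hf.differentiable hγ.le hzs
  have hfirst := hf.proxFun_freshStep_sub_le hc hL hγ hγL hzs
  have hg := hf.proxFun hγ.le zbar
  have hgc := convexOn_proxFun hc hγ.le zbar
  set g := ALEN.proxFun f γ zbar with hgd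
  set S := ⌈(K : ℝ) / (m : ℝ)⌉₊ with hS
  set R := ‖zs - zbar‖ with hR
  have hR0 : 0 ≤ R := norm_nonneg _
  have hMN : 9 * (m * (L + 3 * γ)) ≤ 2 * M := by
    rw [hM, paramM]; nlinarith
  have hMγ : 6 * (m : ℝ) ^ 2 * γ ≤ M := by
    rw [hM, paramM]; nlinarith
  have hq : 0 ≤ 1 - 47 / 200 * √(3 * γ / (10 * M)) * m := by
    have h1 : (√(3 * γ / (10 * M)) * m) ^ 2 ≤ 1 ^ 2 := by
      rw [mul_pow, Real.sq_sqrt (by positivity), div_mul_eq_mul_div, div_le_iff₀ (by positivity)]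
      nlinarith
    have := (le_abs_self _).trans (abs_le_of_sq_le_sq h1 (by norm_num))
    linarith
  have hiter := hg.iterate_epoch_le hgc (by positivity) hMpos hγ hm hMN hMγ hgrow hq
    (freshStep g L ⟨zbar, 0, 0⟩) S
  have hpow := contraction_pow_le (m := m) hL hm hσ
  change _ ^ S ≤ _ at hpow
  set y := ((epoch g M m)^[S] (freshStep g L ⟨zbar, 0, 0⟩)).point with hy
  set Δ := ‖y - zs‖ with hΔ
  have hΔ0 : 0 ≤ Δ := norm_nonneg _
  have hgap : g y - g zs ≤ ((2 * (m : ℝ)) ^ 16)⁻¹ * (9 * L * R ^ 3) := by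
    refine hiter.trans ?_
    have h0 : 0 ≤ g (freshStep g L ⟨zbar, 0, 0⟩).point - g zs :=
      le_trans (by positivity) (hgrow _)
    exact mul_le_mul hpow hfirst h0 (by positivity)
  have hΔR : Δ ≤ R / (10 * m) := by
    refine le_of_pow_le_pow_left₀ (n := 3) (by norm_num) (by positivity) ?_
    have h1 : γ / 6 * Δ ^ 3 ≤ ((2 * (m : ℝ)) ^ 16)⁻¹ * (9 * L * R ^ 3) := (hgrow y).trans hgap
    -- `54000 = 6 · 9 · 10³` is what cubic growth and the initial gap `9LR³` with `L = γm` require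
    -- for `Δ ≤ R/(10m)`; the exponent 16 is large enough since `2¹⁶ = 65536`, even for `m = 1`.
    have h2 : 54000 * (m : ℝ) ^ 4 ≤ (2 * (m : ℝ)) ^ 16 := by
      have : (m : ℝ) ^ 4 ≤ (m : ℝ) ^ 16 := pow_le_pow_right₀ hm1 (by norm_num)
      rw [mul_pow]
      nlinarith [pow_pos hm0 16]
    have h3 : ((2 * (m : ℝ)) ^ 16)⁻¹ ≤ (54000 * (m : ℝ) ^ 4)⁻¹ := by gcongr
    have h4 : γ / 6 * Δ ^ 3 ≤ (54000 * (m : ℝ) ^ 4)⁻¹ * (9 * L * R ^ 3) :=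
      h1.trans (by gcongr)
    refine le_of_mul_le_mul_left (h4.trans_eq ?_) (show 0 < γ / 6 by positivity)
    rw [← hγm]
    field_simp
    ring
  have hzy : z = crn (gradient g) L y (hessian g y) := hz
  have heq := crn_eq (gradient g) hL y (hg.inner_hessian_comm y) (hg.inner_hessian_nonneg hgc y)
  rw [← hzy] at heq
  have hlen : ‖z - y‖ ≤ 3 * Δ := by
    rw [hΔ, norm_sub_rev y]
    refine norm_crn_step_le (hg.inner_hessian_nonneg hgc y) hL heq ?_
    have h1 := hg.norm_gradient_sub_le y (zs - y)
    rw [add_sub_cancel, hzs] at h1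
    calc ‖gradient g y + hessian g y (zs - y)‖ = ‖0 - gradient g y - hessian g y (zs - y)‖ := by
          rw [← norm_neg]; congr 1; abel
      _ ≤ _ := h1
      _ ≤ _ := by gcongr; linarith
  have hgz := hg.norm_gradient_crn_le hL.le heq
  -- The output is within `4Δ ≤ 4R/10` of `zs`, so `R` may be replaced by the actual displacement
  -- from `z̄`.
  have hdist : 3 / 5 * R ≤ ‖z - zbar‖ := by
    have h1 : R ≤ ‖z - zbar‖ + ‖z - y‖ + Δ := by
      calc R = ‖(z - zbar) - (z - y) - (y - zs)‖ := by rw [hR]; congr 1; abel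
        _ ≤ _ := (norm_sub_le _ _).trans (by gcongr; exact norm_sub_le _ _)
    have h2 : R / (10 * m) ≤ R / 10 := by gcongr; linarith
    linarith
  rw [← gradient_proxFun hf.differentiable zbar z]
  calc ‖gradient g z‖ ≤ (L + 3 * γ + L) / 2 * ‖z - y‖ ^ 2 := hgz
    _ ≤ (L + 3 * L + L) / 2 * (3 * (R / (10 * m))) ^ 2 := by
        gcongr; linarith
    _ = 5 / 8 * (γ / m * (3 / 5 * R) ^ 2) := by
        rw [← hγm]; field_simp; ring
    _ ≤ 5 / 8 * (γ * ‖z - zbar‖ ^ 2) := by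
        gcongr
        exact div_le_self hγ.le hm1

end Solver

end ALEN

namespace ALEN

/-! ### Potential argument for the adaptive step size -/

section Amortized

/-- The potential gain of one step of either kind: `ξ` is the logarithm of (a root of) the progress
measure, `η` that of the step size, `e` the remaining energy, `ω` a threshold for `η - ξ`. -/
lemma amortized_step {ξ ξ' η η' e e' ω β : ℝ} (hβ : 0 < β)
    (h : (Real.exp (3 * ξ) + 1 / 2 * Real.exp η ≤ Real.exp (3 * ξ') ∧ η' = η + β ∧ e' ≤ e) ∨
      (ξ ≤ ξ' ∧ η' = η - β ∧ e' ≤ e - Real.exp (6 * ξ - 6 * η))) :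
    β ≤ (|η - ξ - ω| - |η' - ξ' - ω|) + (ξ' - ξ) +
      2 * β * (Real.exp (6 * β + 6 * ω) * (e - e') +
        6 * Real.exp (β - ω) * (Real.exp (2 * ξ') - Real.exp (2 * ξ)) +
        (ξ' - ξ) / Real.log 2) := by
  have hlog2 : 0 < Real.log 2 := Real.log_pos one_lt_two
  have hξ : ξ ≤ ξ' := by
    rcases h with ⟨h1, -, -⟩ | ⟨h1, -, -⟩
    · have : Real.exp (3 * ξ) ≤ Real.exp (3 * ξ') := by linarith [Real.exp_pos η]
      linarith [Real.exp_le_exp.1 this]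
    · exact h1
  have he : e' ≤ e := by
    rcases h with ⟨-, -, h1⟩ | ⟨-, -, h1⟩
    · exact h1
    · linarith [Real.exp_pos (6 * ξ - 6 * η)]
  set T1 := Real.exp (6 * β + 6 * ω) * (e - e') with hT1
  set T2 := 6 * Real.exp (β - ω) * (Real.exp (2 * ξ') - Real.exp (2 * ξ)) with hT2
  set T3 := (ξ' - ξ) / Real.log 2 with hT3
  have p1 : 0 ≤ T1 := mul_nonneg (Real.exp_pos _).le (sub_nonneg.2 he)
  have p2 : 0 ≤ T2 := mul_nonneg (by positivity)
    (sub_nonneg.2 (Real.exp_le_exp.2 (by linarith)))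
  have p3 : 0 ≤ T3 := div_nonneg (sub_nonneg.2 hξ) hlog2.le
  -- Two ways to pay `β`. A step moving `η - ξ` towards the threshold `ω` from outside a
  -- `β`-neighbourhood is paid by the decrease of the distance (`hbad`). Any other step may increase
  -- the distance by up to `β + (ξ' - ξ)`, but makes `T1 + T2 + T3` at least 1, and the surcharge
  -- `2β` covers the loss (`hgood`).
  have hgood : 1 ≤ T1 + T2 + T3 → -β ≤ (|η - ξ - ω| - |η' - ξ' - ω|) + (ξ' - ξ) →
      β ≤ (|η - ξ - ω| - |η' - ξ' - ω|) + (ξ' - ξ) + 2 * β * (T1 + T2 + T3) := by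
    intro h1 h2
    nlinarith
  have hbad : β ≤ (|η - ξ - ω| - |η' - ξ' - ω|) + (ξ' - ξ) →
      β ≤ (|η - ξ - ω| - |η' - ξ' - ω|) + (ξ' - ξ) + 2 * β * (T1 + T2 + T3) := by
    intro h1
    have : 0 ≤ 2 * β * (T1 + T2 + T3) := by positivity
    linarith
  rcases h with ⟨h1, rfl, -⟩ | ⟨-, rfl, h3⟩
  · by_cases hy : η - ξ - ω < -β
    · apply hbad
      rw [abs_of_neg (show η - ξ - ω < 0 by linarith),
        abs_of_neg (show η + β - ξ' - ω < 0 by linarith)]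
      linarith
    · apply hgood
      -- Either `exp ξ` at most doubles, and then a large step size yields a definite increase of
      -- `exp (2ξ)`, or it more than doubles and `T3` alone pays.
      · by_cases hdbl : ξ' - ξ ≤ Real.log 2
        · have hq : Real.exp ξ' ≤ 2 * Real.exp ξ := by
            rw [← Real.exp_log (show (0 : ℝ) < 2 by norm_num), ← Real.exp_add]
            exact Real.exp_le_exp.2 (by linarith)
          have e3 : ∀ s : ℝ, Real.exp (3 * s) = Real.exp s ^ 3 := fun s => by
            rw [← Real.exp_nat_mul]; norm_num
          have e2 : ∀ s : ℝ, Real.exp (2 * s) = Real.exp s ^ 2 := fun s => by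
            rw [← Real.exp_nat_mul]; norm_num
          have hη : Real.exp ω * Real.exp ξ ≤ Real.exp β * Real.exp η := by
            rw [← Real.exp_add, ← Real.exp_add]
            exact Real.exp_le_exp.2 (by linarith)
          have hmono : Real.exp ξ ≤ Real.exp ξ' := Real.exp_le_exp.2 hξ
          have hT : 1 ≤ T2 := by
            rw [hT2, e2, e2, Real.exp_sub]
            rw [e3, e3] at h1
            have hp := Real.exp_pos ξ
            have hp' := Real.exp_pos ω
            have hb := Real.exp_pos β
            have hh := Real.exp_pos η
            generalize Real.exp ξ = q at *
            generalize Real.exp ξ' = q' at *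
            generalize Real.exp η = h at *
            have k1 : h ≤ 6 * q * (q' ^ 2 - q ^ 2) := by
              have : (q' ^ 3 - q ^ 3) ≤ (q' ^ 2 - q ^ 2) * (q' + q) := by
                nlinarith [mul_nonneg hp.le (mul_nonneg (hp.le.trans hmono) (sub_nonneg.2 hmono))]
              have : (q' ^ 2 - q ^ 2) * (q' + q) ≤ (q' ^ 2 - q ^ 2) * (3 * q) := by
                apply mul_le_mul_of_nonneg_left (by linarith)
                nlinarith
              linarith
            have k2 : Real.exp ω * q ≤ (6 * Real.exp β * (q' ^ 2 - q ^ 2)) * q := by nlinarith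
            have k3 := le_of_mul_le_mul_right k2 hp
            rw [show 6 * (Real.exp β / Real.exp ω) * (q' ^ 2 - q ^ 2) =
              (6 * Real.exp β * (q' ^ 2 - q ^ 2)) / Real.exp ω by ring, le_div_iff₀ hp']
            linarith
          linarith
        · have : 1 ≤ T3 := by rw [hT3, le_div_iff₀ hlog2]; linarith
          linarith
      · have : |η + β - ξ' - ω| ≤ |η - ξ - ω| + |β - (ξ' - ξ)| := by
          rw [show η + β - ξ' - ω = (η - ξ - ω) + (β - (ξ' - ξ)) by ring]
          exact abs_add_le _ _
        have h2 : |β - (ξ' - ξ)| ≤ β + (ξ' - ξ) := by rw [abs_le]; constructor <;> linarith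
        linarith
  · by_cases hy : β < η - ξ - ω
    · apply hbad
      rw [abs_of_pos (show 0 < η - ξ - ω by linarith)]
      have : |η - β - ξ' - ω| ≤ (η - ξ - ω) - β + (ξ' - ξ) := by
        rw [abs_le]; constructor <;> linarith
      linarith
    · apply hgood
      · have : 1 ≤ T1 := by
          calc 1 ≤ Real.exp (6 * β + 6 * ω + (6 * ξ - 6 * η)) := Real.one_le_exp (by linarith)
            _ = Real.exp (6 * β + 6 * ω) * Real.exp (6 * ξ - 6 * η) := Real.exp_add _ _
            _ ≤ T1 := by rw [hT1]; gcongr; linarith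
        linarith
      · have : |η - β - ξ' - ω| ≤ |η - ξ - ω| + |β + (ξ' - ξ)| := by
          rw [show η - β - ξ' - ω = (η - ξ - ω) - (β + (ξ' - ξ)) by ring]
          exact abs_sub _ _
        rw [abs_of_nonneg (show 0 ≤ β + (ξ' - ξ) by linarith)] at this
        linarith

/-- The constant in the iteration bound, as a function of `β = log α / 2`. -/
def iterConst (β : ℝ) : ℝ :=
  (1 + 2 * β / Real.log 2 + 12 * β * Real.exp β + 16 / 7 + 2 * β * Real.exp (6 * β)) / β + 2

lemma iterConst_pos {β : ℝ} (hβ : 0 < β) : 0 < iterConst β := by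
  have : 0 < Real.log 2 := Real.log_pos one_lt_two
  unfold iterConst
  positivity

lemma amortized_bound {ξ η e : ℕ → ℝ} {β : ℝ} (hβ : 0 < β) (h0 : 0 ≤ ξ 1) (hη : η 1 = 3 * ξ 1 + β)
    (he1 : e 1 ≤ 1) (he : ∀ t, 0 ≤ e t)
    (h : ∀ t, 1 ≤ t →
      (Real.exp (3 * ξ t) + 1 / 2 * Real.exp (η t) ≤ Real.exp (3 * ξ (t + 1)) ∧
        η (t + 1) = η t + β ∧ e (t + 1) ≤ e t) ∨
      (ξ t ≤ ξ (t + 1) ∧ η (t + 1) = η t - β ∧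
        e (t + 1) ≤ e t - Real.exp (6 * ξ t - 6 * η t))) {T : ℕ} (hT : 1 ≤ T) :
    (T : ℝ) ≤ iterConst β * Real.exp (12 / 7 * ξ T) := by
  have hlog2 : 0 < Real.log 2 := Real.log_pos one_lt_two
  -- This balances the two totals: the energy term is of order `exp (6ω)`, the growth term of order
  -- `exp (2ξ T - ω)`. Both become `exp (12/7 · ξ T)`, the source of the exponent `2/7` for `A = exp
  -- (6ξ)`.
  set ω := 2 / 7 * ξ T with hω
  set Ψ : ℕ → ℝ := fun t => -|η t - ξ t - ω| + ξ t + 2 * β * (-(Real.exp (6 * β + 6 * ω) * e t) +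
    6 * Real.exp (β - ω) * Real.exp (2 * ξ t) + ξ t / Real.log 2) with hΨ
  have hmain : ∀ t, 1 ≤ t → ξ 1 ≤ ξ t ∧ Ψ 1 + β * (t - 1) ≤ Ψ t := by
    intro t ht
    induction t, ht using Nat.le_induction with
    | base => simp
    | succ t ht ih =>
      constructor
      · refine ih.1.trans ?_
        rcases h t ht with ⟨h1, -, -⟩ | ⟨h1, -, -⟩
        · have : Real.exp (3 * ξ t) ≤ Real.exp (3 * ξ (t + 1)) := by
            linarith [Real.exp_pos (η t)]
          linarith [Real.exp_le_exp.1 this]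
        · exact h1
      · have h1 := amortized_step (ω := ω) hβ (h t ht)
        have h2 := ih.2
        rw [sub_div] at h1
        push_cast
        simp only [hΨ] at h2 ⊢
        linarith
  obtain ⟨hξ, hTΨ⟩ := hmain T hT
  have hξT : 0 ≤ ξ T := h0.trans hξ
  set Q := Real.exp (12 / 7 * ξ T) with hQ
  have hQ1 : 1 ≤ Q := Real.one_le_exp (by positivity)
  have hξQ : ξ T ≤ Q := by
    have := Real.add_one_le_exp (12 / 7 * ξ T)
    linarith
  have e1 : Real.exp (6 * β + 6 * ω) = Real.exp (6 * β) * Q := by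
    rw [hQ, ← Real.exp_add]; congr 1; rw [hω]; ring
  have e2 : Real.exp (β - ω) * Real.exp (2 * ξ T) = Real.exp β * Q := by
    rw [hQ, ← Real.exp_add, ← Real.exp_add]; congr 1; rw [hω]; ring
  have hup : Ψ T ≤ Q + 2 * β * (6 * (Real.exp β * Q) + Q / Real.log 2) := by
    have k1 : 0 ≤ Real.exp (6 * β + 6 * ω) * e T := mul_nonneg (Real.exp_pos _).le (he T)
    have k2 := abs_nonneg (η T - ξ T - ω)
    have k3 : ξ T / Real.log 2 ≤ Q / Real.log 2 := by gcongr
    have k4 : 2 * β * (-(Real.exp (6 * β + 6 * ω) * e T) +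
        6 * Real.exp (β - ω) * Real.exp (2 * ξ T) + ξ T / Real.log 2) ≤
        2 * β * (6 * (Real.exp β * Q) + Q / Real.log 2) := by
      gcongr
      rw [mul_assoc, e2]
      linarith
    simp only [hΨ]
    linarith
  have hlow : -(β + 16 / 7 * Q) - 2 * β * (Real.exp (6 * β) * Q) ≤ Ψ 1 := by
    have k1 : Real.exp (6 * β + 6 * ω) * e 1 ≤ Real.exp (6 * β) * Q := by
      rw [e1]; exact mul_le_of_le_one_right (by positivity) he1
    have k2 : |η 1 - ξ 1 - ω| ≤ β + 16 / 7 * Q := by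
      rw [hη, abs_le, hω]
      constructor <;> linarith
    have k3 : 2 * β * (-(Real.exp (6 * β) * Q)) ≤ 2 * β * (-(Real.exp (6 * β + 6 * ω) * e 1) +
        6 * Real.exp (β - ω) * Real.exp (2 * ξ 1) + ξ 1 / Real.log 2) := by
      gcongr
      have : 0 ≤ 6 * Real.exp (β - ω) * Real.exp (2 * ξ 1) + ξ 1 / Real.log 2 := by positivity
      linarith
    simp only [hΨ]
    linarith
  have hfin : β * T ≤ (1 + 2 * β / Real.log 2 + 12 * β * Real.exp β + 16 / 7 +
      2 * β * Real.exp (6 * β)) * Q + 2 * β * Q := by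
    have : β ≤ β * Q := le_mul_of_one_le_right hβ.le hQ1
    have e3 : 2 * β * (6 * (Real.exp β * Q) + Q / Real.log 2) =
      (2 * β / Real.log 2 + 12 * β * Real.exp β) * Q := by ring
    rw [e3] at hup
    linarith
  unfold iterConst
  refine le_of_mul_le_mul_left (hfin.trans_eq ?_) hβ
  field_simp

/-- Growth of the weights `A` when every step either increases `√A` by half the step size and
enlarges the step size, or pays energy and shrinks it. -/
theorem growth_of_alternating_steps {A ℓ e : ℕ → ℝ} {α : ℝ} (hα : 1 < α) (hℓ : ∀ t, 0 < ℓ t)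
    (he : ∀ t, 0 ≤ e t) (he0 : e 0 ≤ 1) (hA1 : A 1 = 1 / ℓ 0) (hℓ1 : ℓ 1 = 1 / α * ℓ 0)
    (he1 : e 1 ≤ e 0 - ℓ 0 ^ 2)
    (h : ∀ t, 1 ≤ t →
      (√(A t) + 1 / (2 * √(ℓ t)) ≤ √(A (t + 1)) ∧ ℓ (t + 1) = 1 / α * ℓ t ∧ e (t + 1) ≤ e t) ∨
      (A t ≤ A (t + 1) ∧ ℓ (t + 1) = α * ℓ t ∧ e (t + 1) ≤ e t - A t * ℓ t ^ 3))
    {T : ℕ} (hT : 1 ≤ T) :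
    (T : ℝ) ≤ iterConst (Real.log α / 2) * A T ^ (2 / 7 : ℝ) := by
  have hA : ∀ t, 1 ≤ t → 0 < A t := by
    intro t ht
    induction t, ht using Nat.le_induction with
    | base => rw [hA1]; exact one_div_pos.2 (hℓ 0)
    | succ t ht ih =>
      rcases h t ht with ⟨h1, -, -⟩ | ⟨h1, -, -⟩
      · have : 0 < √(A (t + 1)) := by
          have := Real.sqrt_pos.2 ih
          have := Real.sqrt_pos.2 (hℓ t)
          have : 0 < √(A t) + 1 / (2 * √(ℓ t)) := by positivity
          linarith
        exact Real.sqrt_pos.1 this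
      · linarith
  have hα0 : 0 < α := by linarith
  have hβ : 0 < Real.log α / 2 := by have := Real.log_pos hα; positivity
  have hexpA : ∀ t, 1 ≤ t → Real.exp (3 * (1 / 6 * Real.log (A t))) = √(A t) := by
    intro t ht
    rw [Real.sqrt_eq_rpow, Real.rpow_def_of_pos (hA t ht)]; congr 1; ring
  have hexpl : ∀ t, Real.exp (-(1 / 2 * Real.log (ℓ t))) = 1 / √(ℓ t) := by
    intro t
    rw [Real.exp_neg, mul_comm, Real.sqrt_eq_rpow, Real.rpow_def_of_pos (hℓ t),
      one_div (Real.exp _)]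
  -- The energy drop of the first iteration cannot exceed the initial energy; this makes `ξ 1`
  -- nonnegative.
  have hℓ0 : ℓ 0 ≤ 1 := by
    have := he 1
    nlinarith [hℓ 0]
  -- The substitution makes `exp (3ξ) = √A` and `exp η = 1/√ℓ`, so a change of `ℓ` by `α` shifts `η`
  -- by `log α / 2`, and `A ℓ³ = exp (6ξ - 6η)`.
  have hmain := amortized_bound (ξ := fun t => 1 / 6 * Real.log (A t))
    (η := fun t => -(1 / 2 * Real.log (ℓ t))) (e := e) hβ ?_ ?_ ?_ he ?_ hT
  · rw [Real.rpow_def_of_pos (hA T hT)]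
    convert hmain using 3
    ring
  · simp only [hA1]
    have : 0 ≤ Real.log (1 / ℓ 0) := Real.log_nonneg (by rw [le_div_iff₀ (hℓ 0)]; linarith)
    positivity
  · simp only [hA1, hℓ1]
    rw [Real.log_mul (by positivity) (hℓ 0).ne']
    simp only [one_div, Real.log_inv]
    ring
  · nlinarith [sq_nonneg (ℓ 0)]
  · intro t ht
    rcases h t ht with ⟨h1, h2, h3⟩ | ⟨h1, h2, h3⟩
    · left
      refine ⟨?_, ?_, h3⟩
      · rw [hexpA t ht, hexpA (t + 1) (by omega), hexpl]
        calc _ = √(A t) + 1 / (2 * √(ℓ t)) := by ring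
          _ ≤ _ := h1
      · simp only [h2]
        rw [Real.log_mul (by positivity) (hℓ t).ne']
        simp only [one_div, Real.log_inv]
        ring
    · right
      refine ⟨?_, ?_, ?_⟩
      · have := Real.log_le_log (hA t ht) h1
        linarith
      · simp only [h2]
        rw [Real.log_mul hα0.ne' (hℓ t).ne']
        ring
      · refine h3.trans_eq ?_
        congr 1
        rw [show 6 * (1 / 6 * Real.log (A t)) - 6 * (-(1 / 2 * Real.log (ℓ t))) =
          Real.log (A t) + (3 : ℕ) * Real.log (ℓ t) by push_cast; ring, Real.exp_add,
          Real.exp_nat_mul, Real.exp_log (hA t ht), Real.exp_log (hℓ t)]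

end Amortized

end ALEN

namespace ALEN

open scoped RealInnerProductSpace

/-! ### Energy analysis of the outer loop -/

section Outer

/-- The step-size equation solved by `a'`. -/
lemma stepsize_spec {l A : ℝ} (hl : 0 < l) (hA : 0 ≤ A) :
    0 < 1 / (2 * l) * (1 + √(1 + 4 * l * A)) ∧
    l * (1 / (2 * l) * (1 + √(1 + 4 * l * A))) ^ 2 = A + 1 / (2 * l) * (1 + √(1 + 4 * l * A)) ∧
    1 ≤ 2 * l * (1 / (2 * l) * (1 + √(1 + 4 * l * A))) := by
  have hs : √(1 + 4 * l * A) ^ 2 = 1 + 4 * l * A := Real.sq_sqrt (by positivity)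
  have hs0 : 0 ≤ √(1 + 4 * l * A) := Real.sqrt_nonneg _
  generalize √(1 + 4 * l * A) = r at *
  refine ⟨by positivity, ?_, ?_⟩
  · field_simp
    nlinarith
  · have : 2 * l * (1 / (2 * l) * (1 + r)) = 1 + r := by
      field_simp
    rw [this]; linarith

/-- By the step-size equation `√(A + a) = √l · a`, and completing the square in `A = l a² - a` gives
the increment. -/
lemma sqrt_add_le_sqrt {l A a : ℝ} (hl : 0 < l) (ha : l * a ^ 2 = A + a) (ha0 : 0 < a)
    (h1 : 1 ≤ 2 * l * a) : √A + 1 / (2 * √l) ≤ √(A + a) := by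
  have hu : 0 < √l := Real.sqrt_pos.2 hl
  have hul : √l ^ 2 = l := Real.sq_sqrt hl.le
  have e : √(A + a) = √l * a := by
    rw [← ha, Real.sqrt_mul hl.le, Real.sqrt_sq ha0.le]
  rw [e]
  set u := √l
  suffices √A ≤ u * a - 1 / (2 * u) by linarith
  apply Real.sqrt_le_iff.2
  constructor
  · rw [sub_nonneg, div_le_iff₀ (by positivity)]
    nlinarith
  · have : (u * a - 1 / (2 * u)) ^ 2 = u ^ 2 * a ^ 2 - a + 1 / (4 * u ^ 2) := by
      field_simp; ring
    rw [this, hul, ha]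
    have : 0 < 1 / (4 * l) := by positivity
    linarith

/-- The energy of a state relative to a reference point. -/
def energy {V : Type*} [NormedAddCommGroup V] (f : V → ℝ) (zs : V) (s : State V) : ℝ :=
  s.A * (f s.z - f zs) + 1 / 2 * ‖s.v - zs‖ ^ 2

lemma energy_nonneg {V : Type*} [NormedAddCommGroup V] {f : V → ℝ} {zs : V}
    (hmin : ∀ z, f zs ≤ f z) {s : State V} (hA : 0 ≤ s.A) :
    0 ≤ energy f zs s := by
  have := sub_nonneg.2 (hmin s.z)
  unfold energy
  positivity

variable {E : Type*} [NormedAddCommGroup E] [InnerProductSpace ℝ E] [CompleteSpace E]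
  {f : E → ℝ}

/-- The energy inequality behind both kinds of outer steps; `ρ` is the damping factor. -/
lemma energy_core (hc : ConvexOn ℝ Set.univ f) (hf : Differentiable ℝ f) {A a l lam ρ : ℝ}
    (hA : 0 ≤ A) (ha : 0 < a) (hl : 0 < l) (hla : l * a ^ 2 = A + a) (hlam : 0 ≤ lam)
    (hρ : 0 ≤ ρ) (hρl : ρ * lam ≤ l) {z v zs zt zbar : E}
    (hzbar : zbar = (A / (A + a)) • z + (a / (A + a)) • v)
    (hMS : ‖gradient f zt + lam • (zt - zbar)‖ ≤ 5 / 8 * (lam * ‖zt - zbar‖)) :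
    ρ * ((A + a) * f zt - A * f z - a * f zs) +
        1 / 2 * ‖v - (ρ * a) • gradient f zt - zs‖ ^ 2 ≤
      1 / 2 * ‖v - zs‖ ^ 2 - 39 / 128 * (ρ * (A + a) * (lam * ‖zt - zbar‖ ^ 2)) := by
  have hAa : 0 < A + a := by linarith
  set G := gradient f zt with hG
  set x := zt - zbar with hx
  have c1 := add_inner_gradient_le hc hf zt z
  have c2 := add_inner_gradient_le hc hf zt zs
  have hcomb : (A + a) • zbar = A • z + a • v := by
    rw [hzbar, smul_add, smul_smul, smul_smul, mul_div_cancel₀ _ hAa.ne',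
      mul_div_cancel₀ _ hAa.ne']
  have hvec : (A + a) • x + a • (v - zs) = -(A • (z - zt) + a • (zs - zt)) := by
    rw [hx, smul_sub (A + a), hcomb]; module
  have hlin : (A + a) * f zt - A * f z - a * f zs ≤ (A + a) * ⟪G, x⟫ + a * ⟪G, v - zs⟫ := by
    have h1 := mul_le_mul_of_nonneg_left c1 hA
    have h2 := mul_le_mul_of_nonneg_left c2 ha.le
    have h3 := congrArg (fun y => ⟪G, y⟫) hvec
    simp only [inner_add_right, inner_smul_right, inner_neg_right] at h3
    linarith
  have hsq : ‖v - (ρ * a) • G - zs‖ ^ 2 =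
      ‖v - zs‖ ^ 2 - 2 * (ρ * a) * ⟪G, v - zs⟫ + (ρ * a) ^ 2 * ‖G‖ ^ 2 := by
    rw [show v - (ρ * a) • G - zs = (v - zs) - (ρ * a) • G by abel, norm_sub_sq_real,
      inner_smul_right, norm_smul, Real.norm_of_nonneg (by positivity), real_inner_comm, mul_pow]
    ring
  -- Squaring the Monteiro–Svaiter condition produces the constant `39/128 = (1 - (5/8)²)/2`. The
  -- damping `ρ lam ≤ l` lets the `‖G‖²` term from the update of `v` be absorbed at scale `l`.
  have hquad : l * ⟪G, x⟫ + ρ / 2 * ‖G‖ ^ 2 ≤ -(39 / 128 * (l * (lam * ‖x‖ ^ 2))) := by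
    rcases hlam.eq_or_lt with h0 | hpos
    · rw [← h0] at hMS ⊢
      have : G = 0 := by
        rw [← norm_le_zero_iff]; simpa using hMS
      simp [this]
    · have h1 : ‖G + lam • x‖ ^ 2 ≤ (5 / 8 * (lam * ‖x‖)) ^ 2 := by gcongr
      rw [norm_add_sq_real, inner_smul_right, norm_smul, Real.norm_of_nonneg hlam] at h1
      have h2 : lam * ⟪G, x⟫ + 1 / 2 * ‖G‖ ^ 2 ≤ -(39 / 128 * (lam * (lam * ‖x‖ ^ 2))) := by
        nlinarith
      have h3 : l * (lam * ⟪G, x⟫ + 1 / 2 * ‖G‖ ^ 2) ≤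
          l * -(39 / 128 * (lam * (lam * ‖x‖ ^ 2))) := mul_le_mul_of_nonneg_left h2 hl.le
      have h4 : ρ * lam * ‖G‖ ^ 2 ≤ l * ‖G‖ ^ 2 := by gcongr
      refine le_of_mul_le_mul_left ?_ hpos
      nlinarith
  have hq2 : ρ * a ^ 2 * (l * ⟪G, x⟫ + ρ / 2 * ‖G‖ ^ 2) ≤
      ρ * a ^ 2 * -(39 / 128 * (l * (lam * ‖x‖ ^ 2))) :=
    mul_le_mul_of_nonneg_left hquad (by positivity)
  have hl1 := mul_le_mul_of_nonneg_left hlin hρ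
  have e1 : ρ * a ^ 2 * (l * ⟪G, x⟫ + ρ / 2 * ‖G‖ ^ 2) =
      ρ * (A + a) * ⟪G, x⟫ + 1 / 2 * ((ρ * a) ^ 2 * ‖G‖ ^ 2) := by rw [← hla]; ring
  have e2 : ρ * a ^ 2 * -(39 / 128 * (l * (lam * ‖x‖ ^ 2))) =
      -(39 / 128 * (ρ * (A + a) * (lam * ‖x‖ ^ 2))) := by rw [← hla]; ring
  rw [e1, e2] at hq2
  rw [hsq]
  linarith

/-- A solver whose output always satisfies the Monteiro–Svaiter condition. -/
def IsMSSolver (f : E → ℝ) (γ : ℝ) (solve : E → Counted E) : Prop :=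
  ∀ zbar, ‖gradient f (solve zbar).point +
      (γ * ‖(solve zbar).point - zbar‖) • ((solve zbar).point - zbar)‖ ≤
    5 / 8 * (γ * ‖(solve zbar).point - zbar‖ * ‖(solve zbar).point - zbar‖)

variable {solve : E → Counted E} {α γ : ℝ} {z₀ : E}

/-- The first guess is the value measured by the reused solver call, so the undamped branch is
taken; with `A = 0` the step size is `1/λ'`. The energy drop is kept because it bounds the initial
`λ'`. -/
lemma run_one_spec (hc : ConvexOn ℝ Set.univ f) (hf : Differentiable ℝ f) (hγ : 0 < γ)
    (hMS : IsMSSolver f γ solve) (hne : 0 < (run f solve α γ z₀ 0).lam') (zs : E) :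
    (run f solve α γ z₀ 1).A = 1 / (run f solve α γ z₀ 0).lam' ∧
    (run f solve α γ z₀ 1).lam' = 1 / α * (run f solve α γ z₀ 0).lam' ∧
    energy f zs (run f solve α γ z₀ 1) ≤ energy f zs (run f solve α γ z₀ 0) -
      39 / 128 * ((run f solve α γ z₀ 0).lam' ^ 2 / γ ^ 2) := by
  have hA0 : (run f solve α γ z₀ 0).A = 0 := rfl
  have hv0 : (run f solve α γ z₀ 0).v = z₀ := rfl
  have hl0 : (run f solve α γ z₀ 0).lam' = γ * ‖(solve z₀).point - z₀‖ := rfl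
  set s := run f solve α γ z₀ 0 with hs
  have ha' : 1 / (2 * s.lam') * (1 + √(1 + 4 * s.lam' * s.A)) = 1 / s.lam' := by
    rw [hA0]; simp; field_simp; norm_num
  have hrun : run f solve α γ z₀ 1 =
      { z := (solve z₀).point
        v := s.v - (1 / s.lam') • gradient f (solve z₀).point
        A := s.A + 1 / s.lam'
        lam' := 1 / α * s.lam'
        steps := s.steps + 0
        hessians := s.hessians + 0 } := by
    rw [run, ← hs]
    simp only [ha', if_true, le_refl]
  rw [hrun]
  refine ⟨by simp [hA0], rfl, ?_⟩
  have core := energy_core hc hf (A := 0) (a := 1 / s.lam') (l := s.lam') (lam := s.lam')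
    (ρ := 1) le_rfl (by positivity) hne (by field_simp; simp) hne.le zero_le_one (by simp)
    (z := z₀) (v := z₀) (zs := zs) (zt := (solve z₀).point) (zbar := z₀)
    (by simp [hne.ne']) (by rw [hl0]; exact hMS z₀)
  have e : 1 * (0 + 1 / s.lam') * (s.lam' * ‖(solve z₀).point - z₀‖ ^ 2) =
      s.lam' ^ 2 / γ ^ 2 := by
    rw [hl0] at hne ⊢
    have : ‖(solve z₀).point - z₀‖ ≠ 0 := by
      intro h; simp [h] at hne
    field_simp
    ring
  rw [e] at core
  simp only [energy, hA0, hv0, one_mul, zero_add, zero_mul, sub_zero] at core ⊢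
  linarith

/-- An accepted guess gives growth of `√A` at no energy cost. A rejected one is damped by `ρ = λ'/λ
< 1`, which makes `energy_core` applicable with the guessed step size, and the large displacement
`λ/γ > λ'/γ` supplies the energy drop. -/
lemma run_succ_spec (hc : ConvexOn ℝ Set.univ f) (hf : Differentiable ℝ f) (hγ : 0 < γ)
    (hMS : IsMSSolver f γ solve) {t : ℕ} (ht : 1 ≤ t) (hl : 0 < (run f solve α γ z₀ t).lam')
    (hA : 0 ≤ (run f solve α γ z₀ t).A) (zs : E) :
    (√(run f solve α γ z₀ t).A + 1 / (2 * √(run f solve α γ z₀ t).lam') ≤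
        √(run f solve α γ z₀ (t + 1)).A ∧
      (run f solve α γ z₀ (t + 1)).lam' = 1 / α * (run f solve α γ z₀ t).lam' ∧
      energy f zs (run f solve α γ z₀ (t + 1)) ≤ energy f zs (run f solve α γ z₀ t)) ∨
    ((run f solve α γ z₀ t).A ≤ (run f solve α γ z₀ (t + 1)).A ∧
      (run f solve α γ z₀ (t + 1)).lam' = α * (run f solve α γ z₀ t).lam' ∧
      energy f zs (run f solve α γ z₀ (t + 1)) ≤ energy f zs (run f solve α γ z₀ t) -
        39 / 128 * ((run f solve α γ z₀ t).A * (run f solve α γ z₀ t).lam' ^ 3 / γ ^ 2)) := by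
  set s := run f solve α γ z₀ t with hs
  obtain ⟨ha0, hla, ha1⟩ := stepsize_spec hl hA
  rw [run, ← hs]
  simp only [if_neg (show t ≠ 0 by omega)]
  set a := 1 / (2 * s.lam') * (1 + √(1 + 4 * s.lam' * s.A)) with had
  set zbar := (s.A / (s.A + a)) • s.z + (a / (s.A + a)) • s.v with hzbar
  set zt := (solve zbar).point with hzt
  set lam := γ * ‖zt - zbar‖ with hlamd
  have hlam : 0 ≤ lam := by positivity
  have hms : ‖gradient f zt + lam • (zt - zbar)‖ ≤ 5 / 8 * (lam * ‖zt - zbar‖) := hMS zbar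
  have hAa : 0 < s.A + a := by linarith
  split_ifs with hle
  · left
    refine ⟨sqrt_add_le_sqrt hl hla ha0 ha1, rfl, ?_⟩
    have core := energy_core hc hf (ρ := 1) hA ha0 hl hla hlam zero_le_one (by linarith)
      (zs := zs) hzbar hms
    have hnn : 0 ≤ 39 / 128 * (1 * (s.A + a) * (lam * ‖zt - zbar‖ ^ 2)) := by positivity
    simp only [energy, one_mul] at core hnn ⊢
    linarith
  · right
    push Not at hle
    have hlampos : 0 < lam := hl.trans hle
    set ρ := s.lam' / lam with hρd
    have hρ0 : 0 < ρ := by positivity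
    have hρ1 : ρ ≤ 1 := by rw [hρd, div_le_one hlampos]; exact hle.le
    have hρlam : ρ * lam = s.lam' := by rw [hρd]; field_simp
    have hAn : 0 < s.A + ρ * a := by positivity
    refine ⟨by simp only; linarith [mul_pos hρ0 ha0], rfl, ?_⟩
    have core := energy_core hc hf hA ha0 hl hla hlam hρ0.le hρlam.le (zs := zs) hzbar hms
    have hconv := hc.2 (Set.mem_univ s.z) (Set.mem_univ zt)
      (show 0 ≤ (1 - ρ) * s.A / (s.A + ρ * a) from
        div_nonneg (mul_nonneg (by linarith) hA) hAn.le)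
      (show 0 ≤ ρ * (s.A + a) / (s.A + ρ * a) by positivity)
      (by field_simp; ring)
    -- The weights of the damped average are exactly those for which convexity matches the function
    -- values in `energy_core`.
    have hconv' : (s.A + ρ * a) * f (((1 - ρ) * s.A / (s.A + ρ * a)) • s.z +
        (ρ * (s.A + a) / (s.A + ρ * a)) • zt) ≤ (1 - ρ) * s.A * f s.z + ρ * (s.A + a) * f zt := by
      refine (mul_le_mul_of_nonneg_left hconv hAn.le).trans_eq ?_
      simp only [smul_eq_mul]
      field_simp
    have hgain : s.A * s.lam' ^ 3 / γ ^ 2 ≤ ρ * (s.A + a) * (lam * ‖zt - zbar‖ ^ 2) := by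
      have e : ‖zt - zbar‖ = lam / γ := by rw [hlamd]; field_simp
      rw [e, show ρ * (s.A + a) * (lam * (lam / γ) ^ 2) = (s.A + a) * (ρ * lam) * lam ^ 2 / γ ^ 2
        by ring, hρlam]
      have h1 : s.A * s.lam' ^ 3 ≤ (s.A + a) * s.lam' * lam ^ 2 := by
        calc s.A * s.lam' ^ 3 = s.A * s.lam' * s.lam' ^ 2 := by ring
          _ ≤ _ := by gcongr; linarith
      gcongr
    simp only [energy]
    linarith

/-- Convergence of the outer loop with an arbitrary Monteiro–Svaiter solver. -/
theorem run_gap_le (hc : ConvexOn ℝ Set.univ f) (hf : Differentiable ℝ f) (hγ : 0 < γ)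
    (hα : 1 < α) (hMS : IsMSSolver f γ solve) {zs : E} (hmin : ∀ z, f zs ≤ f z)
    (hz₀ : f zs < f z₀) {D : ℝ} (hD : 0 < D) (hD0 : ‖z₀ - zs‖ ≤ D) {T : ℕ} (hT : 1 ≤ T) :
    0 ≤ (run f solve α γ z₀ T).A ∧
    (T : ℝ) ≤ iterConst (Real.log α / 2) *
      ((run f solve α γ z₀ T).A * (√2 * γ * D)) ^ (2 / 7 : ℝ) ∧
    (run f solve α γ z₀ T).A * (f (run f solve α γ z₀ T).z - f zs) ≤ D ^ 2 / 2 := by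
  have hl0 : 0 < (run f solve α γ z₀ 0).lam' := by
    have h1 : (run f solve α γ z₀ 0).lam' = γ * ‖(solve z₀).point - z₀‖ := rfl
    rw [h1]
    -- If the solver did not move, the Monteiro–Svaiter condition would give zero gradient at `z₀`,
    -- making it a minimizer.
    refine mul_pos hγ (norm_pos_iff.2 fun h0 => ?_)
    have h2 := hMS z₀
    rw [h0] at h2
    have h3 : gradient f (solve z₀).point = 0 := by
      rw [← norm_le_zero_iff]; simpa using h2
    rw [sub_eq_zero.1 h0] at h3
    have h4 := add_inner_gradient_le hc hf z₀ zs
    rw [h3, inner_zero_left] at h4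
    linarith
  have hE0 : energy f zs (run f solve α γ z₀ 0) ≤ D ^ 2 / 2 := by
    have : energy f zs (run f solve α γ z₀ 0) = 1 / 2 * ‖z₀ - zs‖ ^ 2 := by
      simp [energy, run]
    rw [this]
    have : ‖z₀ - zs‖ ^ 2 ≤ D ^ 2 := by gcongr
    linarith
  obtain ⟨hA1, hl1, hE1⟩ := run_one_spec (α := α) hc hf hγ hMS hl0 zs
  have hα0 : 0 < α := by linarith
  have hinv : ∀ t, 1 ≤ t → 0 < (run f solve α γ z₀ t).lam' ∧ 0 ≤ (run f solve α γ z₀ t).A := by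
    intro t ht
    induction t, ht using Nat.le_induction with
    | base => rw [hA1, hl1]; exact ⟨by positivity, by positivity⟩
    | succ t ht ih =>
      rcases run_succ_spec hc hf hγ hMS ht ih.1 ih.2 zs with ⟨h1, h2, -⟩ | ⟨h1, h2, -⟩
      · refine ⟨by rw [h2]; have := ih.1; positivity, ?_⟩
        by_contra! hneg
        rw [Real.sqrt_eq_zero_of_nonpos hneg.le] at h1
        have := Real.sqrt_pos.2 ih.1
        have : 0 < √(run f solve α γ z₀ t).A + 1 / (2 * √(run f solve α γ z₀ t).lam') := by
          positivity
        linarith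
      · exact ⟨by rw [h2]; have := ih.1; positivity, ih.2.trans h1⟩
  have hlam : ∀ t, 0 < (run f solve α γ z₀ t).lam' := by
    intro t
    rcases Nat.eq_zero_or_pos t with rfl | ht
    · exact hl0
    · exact (hinv t ht).1
  have hApos : ∀ t, 0 ≤ (run f solve α γ z₀ t).A := by
    intro t
    rcases Nat.eq_zero_or_pos t with rfl | ht
    · exact le_rfl
    · exact (hinv t ht).2
  have hEdec : ∀ t, energy f zs (run f solve α γ z₀ t) ≤ D ^ 2 / 2 := by
    intro t
    induction t with
    | zero => exact hE0
    | succ t ih =>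
      rcases Nat.eq_zero_or_pos t with rfl | ht
      · have : 0 ≤ 39 / 128 * ((run f solve α γ z₀ 0).lam' ^ 2 / γ ^ 2) := by positivity
        exact le_trans (by linarith) ih
      · rcases run_succ_spec hc hf hγ hMS ht (hlam t) (hApos t) zs with ⟨-, -, h1⟩ | ⟨-, -, h1⟩
        · exact h1.trans ih
        · have : 0 ≤ 39 / 128 * ((run f solve α γ z₀ t).A *
              (run f solve α γ z₀ t).lam' ^ 3 / γ ^ 2) := by
            have := hApos t
            have := hlam t
            positivity
          linarith
  refine ⟨hApos T, ?_, ?_⟩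
  -- The rescaling `A κ`, `λ'/κ` and `2E/D²` normalizes the energy budget to 1; with `κ² = 2γ²D²`
  -- the factor `39/128` becomes `39/32 ≥ 1` and can be dropped.
  · set κ := √2 * γ * D with hκ
    have hκ0 : 0 < κ := by positivity
    have hκ2 : κ ^ 2 = 2 * γ ^ 2 * D ^ 2 := by
      rw [hκ, mul_pow, mul_pow, Real.sq_sqrt (by norm_num)]
    have hsc : ∀ y : ℝ, 0 ≤ y → 2 / D ^ 2 * (39 / 128 * (y / γ ^ 2)) ≥ y / κ ^ 2 := by
      intro y hy
      rw [hκ2, show 2 / D ^ 2 * (39 / 128 * (y / γ ^ 2)) = 39 / 32 * (y / (2 * γ ^ 2 * D ^ 2)) by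
        field_simp; ring]
      have : 0 ≤ y / (2 * γ ^ 2 * D ^ 2) := by positivity
      linarith
    refine growth_of_alternating_steps (A := fun t => (run f solve α γ z₀ t).A * κ)
      (ℓ := fun t => (run f solve α γ z₀ t).lam' / κ)
      (e := fun t => 2 / D ^ 2 * energy f zs (run f solve α γ z₀ t)) hα
      (fun t => div_pos (hlam t) hκ0)
      (fun t => mul_nonneg (by positivity) (energy_nonneg hmin (hApos t))) ?_ ?_ ?_ ?_ ?_ hT
    · calc _ ≤ 2 / D ^ 2 * (D ^ 2 / 2) := mul_le_mul_of_nonneg_left hE0 (by positivity)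
        _ = 1 := by field_simp
    · simp only [hA1]
      field_simp
    · simp only [hl1]
      ring
    · have h1 := mul_le_mul_of_nonneg_left hE1 (show 0 ≤ 2 / D ^ 2 by positivity)
      have h2 := hsc ((run f solve α γ z₀ 0).lam' ^ 2) (by positivity)
      rw [mul_sub] at h1
      simp only [div_pow]
      linarith
    · intro t ht
      rcases run_succ_spec hc hf hγ hMS ht (hlam t) (hApos t) zs with
        ⟨h1, h2, h3⟩ | ⟨h1, h2, h3⟩
      · left
        refine ⟨?_, by simp only [h2]; ring, mul_le_mul_of_nonneg_left h3 (by positivity)⟩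
        rw [Real.sqrt_mul (hApos t), Real.sqrt_mul (hApos (t + 1)), Real.sqrt_div (hlam t).le]
        have hk := Real.sqrt_pos.2 hκ0
        have hll := Real.sqrt_pos.2 (hlam t)
        calc _ = (√(run f solve α γ z₀ t).A + 1 / (2 * √(run f solve α γ z₀ t).lam')) * √κ := by
              field_simp
          _ ≤ _ := by gcongr
      · right
        refine ⟨mul_le_mul_of_nonneg_right h1 hκ0.le, by simp only [h2]; ring, ?_⟩
        have h4 := mul_le_mul_of_nonneg_left h3 (show 0 ≤ 2 / D ^ 2 by positivity)
        have h5 := hsc ((run f solve α γ z₀ t).A * (run f solve α γ z₀ t).lam' ^ 3)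
          (mul_nonneg (hApos t) (pow_nonneg (hlam t).le 3))
        rw [mul_sub] at h4
        have e : (run f solve α γ z₀ t).A * κ * ((run f solve α γ z₀ t).lam' / κ) ^ 3 =
            (run f solve α γ z₀ t).A * (run f solve α γ z₀ t).lam' ^ 3 / κ ^ 2 := by
          field_simp
        rw [e]
        linarith
  · have h1 := hEdec T
    have h2 : 0 ≤ 1 / 2 * ‖(run f solve α γ z₀ T).v - zs‖ ^ 2 := by positivity
    unfold energy at h1
    linarith

/-- The initial state already carries the cost of one call and the first iteration adds none, so
after `t + 1` iterations exactly `t + 1` calls are counted. -/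
lemma run_counts {p h : ℕ} (hsolve : ∀ z, (solve z).steps = p ∧ (solve z).hessians = h) (t : ℕ) :
    (run f solve α γ z₀ (t + 1)).steps = (t + 1) * p ∧
      (run f solve α γ z₀ (t + 1)).hessians = (t + 1) * h := by
  induction t with
  | zero =>
    rw [run]
    simp only [if_true]
    split_ifs <;> simp [run, hsolve]
  | succ t ih =>
    rw [run]
    simp only [if_neg (Nat.succ_ne_zero t)]
    split_ifs <;> simp only [ih, hsolve] <;> constructor <;> ring

end Outer

end ALEN

namespace ALEN

/-! ### Parameter bounds and total cost -/

section Complexity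

lemma paramM_le {L : ℝ} {m : ℕ} (hL : 0 < L) (hm : 1 ≤ m) :
    paramM L (L / m) m ≤ 18 * (m * L) := by
  have hm1 : (1 : ℝ) ≤ m := by exact_mod_cast hm
  have h1 : L / m ≤ L := div_le_self hL.le hm1
  have h2 : 0 < (m : ℝ) * L := by positivity
  unfold paramM
  nlinarith

lemma paramK_le {L σ : ℝ} {m : ℕ} (hL : 0 < L) (hm : 1 ≤ m) (hσ : 0 < σ) (hσ' : σ ≤ 99 / 100) :
    (paramK σ L (L / m) m : ℝ) ≤ 1475 * (m * (1 + Real.log m)) := by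
  have hm1 : (1 : ℝ) ≤ m := by exact_mod_cast hm
  have hm0 : (0 : ℝ) < m := by linarith
  have hlm : 0 ≤ Real.log m := Real.log_nonneg hm1
  have e : L / (paramc σ * (L / m)) = 2 * (1 + 2 * σ) * m := by
    unfold paramc
    field_simp
  have hlog : Real.log (L / (paramc σ * (L / m))) ≤ 2 * (1 + Real.log m) := by
    -- For `σ ≤ 99/100` the argument is at most `5.96 < e²`.
    have h6 : Real.log (2 * (1 + 2 * σ)) ≤ 2 := by
      rw [Real.log_le_iff_le_exp (by positivity)]
      have h1 := Real.exp_one_gt_d9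
      have h2 : Real.exp 2 = Real.exp 1 * Real.exp 1 := by rw [← Real.exp_add]; norm_num
      rw [h2]
      nlinarith
    rw [e, Real.log_mul (by positivity) (by positivity)]
    linarith
  have hlog0 : 0 ≤ Real.log (L / (paramc σ * (L / m))) :=
    le_trans (Real.log_nonneg (by linarith)) (log_two_mul_le hL hm hσ)
  have hW : √(paramM L (L / m) m / (L / m)) ≤ 5 * m := by
    rw [paramM_div hL hm]
    apply Real.sqrt_le_iff.2
    constructor
    · positivity
    · nlinarith
  have hceil : (paramK σ L (L / m) m : ℝ) ≤ 3 / 2 * (m + 98 * √(paramM L (L / m) m / (L / m))) *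
      Real.log (L / (paramc σ * (L / m))) + 1 := by
    unfold paramK
    exact (Nat.ceil_lt_add_one (by positivity)).le
  calc _ ≤ 3 / 2 * (m + 98 * √(paramM L (L / m) m / (L / m))) *
      Real.log (L / (paramc σ * (L / m))) + 1 := hceil
    _ ≤ 3 / 2 * (m + 98 * (5 * m)) * (2 * (1 + Real.log m)) + 1 := by gcongr
    _ ≤ _ := by nlinarith [mul_nonneg hm0.le hlm]

lemma epochs_le {L σ : ℝ} {m : ℕ} (hL : 0 < L) (hm : 1 ≤ m) (hσ : 0 < σ) (hσ' : σ ≤ 99 / 100) :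
    (⌈(paramK σ L (L / m) m : ℝ) / (m : ℝ)⌉₊ : ℝ) + 2 ≤ 1478 * (1 + Real.log m) := by
  have hm1 : (1 : ℝ) ≤ m := by exact_mod_cast hm
  have hm0 : (0 : ℝ) < m := by linarith
  have hlm : 0 ≤ Real.log m := Real.log_nonneg hm1
  have h1 : (⌈(paramK σ L (L / m) m : ℝ) / (m : ℝ)⌉₊ : ℝ) ≤
      (paramK σ L (L / m) m : ℝ) / (m : ℝ) + 1 := (Nat.ceil_lt_add_one (by positivity)).le
  have h2 : (paramK σ L (L / m) m : ℝ) / (m : ℝ) ≤ 1475 * (1 + Real.log m) := by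
    rw [div_le_iff₀ hm0]
    linarith [paramK_le hL hm hσ hσ']
  linarith

lemma isMSSolver_msSolver {E : Type*} [NormedAddCommGroup E] [InnerProductSpace ℝ E]
    [CompleteSpace E] [ProperSpace E] {f : E → ℝ} {L σ lb : ℝ} {m : ℕ}
    (hc : ConvexOn ℝ Set.univ f) (hf : HasLipschitzHessian f L) (hL : 0 < L) (hm : 1 ≤ m)
    (hσ : 0 < σ) (hlb : ∀ z, lb ≤ f z) :
    IsMSSolver f (L / m)
      (msSolver f L (paramK σ L (L / m) m) (paramM L (L / m) m) m (L / m)) := by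
  intro zbar
  have := hf.msSolver_condition hc hL hm hσ hlb zbar rfl
  rw [smul_smul] at this
  rwa [mul_assoc (L / (m : ℝ)), ← sq]

/-- The number of outer iterations sufficient for accuracy `ε`. -/
def outerIterations (α L D ε : ℝ) (m : ℕ) : ℕ :=
  ⌊iterConst (Real.log α / 2) * ((m : ℝ) ^ (-(2 / 7) : ℝ) * (L * D ^ 3 / ε) ^ (2 / 7 : ℝ))⌋₊ + 1

theorem alen_gap_le {E : Type*} [NormedAddCommGroup E] [InnerProductSpace ℝ E]
    [CompleteSpace E] [ProperSpace E] {f : E → ℝ} {L α σ D ε : ℝ} {m : ℕ}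
    (hc : ConvexOn ℝ Set.univ f) (hf : HasLipschitzHessian f L) (hL : 0 < L) (hm : 1 ≤ m)
    (hα : 1 < α) (hσ : 0 < σ) (hD : 0 < D) (hε : 0 < ε) {z₀ zs : E}
    (hmin : ∀ z, f zs ≤ f z) (hz₀ : f zs < f z₀) (hD0 : ‖z₀ - zs‖ ≤ D) {T : ℕ}
    (hT : outerIterations α L D ε m ≤ T) :
    f (alen f L m α σ z₀ T).z - f zs ≤ ε := by
  have hm0 : (0 : ℝ) < m := by exact_mod_cast hm
  have hγ : 0 < L / m := by positivity
  have hβ : 0 < Real.log α / 2 := by have := Real.log_pos hα; positivity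
  obtain ⟨hA, hTA, hgap⟩ := run_gap_le hc hf.differentiable hγ hα
    (isMSSolver_msSolver hc hf hL hm hσ hmin) hmin hz₀ hD hD0
    (le_trans (Nat.le_add_left 1 _) hT)
  change 0 ≤ (alen f L m α σ z₀ T).A at hA
  change (T : ℝ) ≤ _ * ((alen f L m α σ z₀ T).A * _) ^ _ at hTA
  change (alen f L m α σ z₀ T).A * (f (alen f L m α σ z₀ T).z - f zs) ≤ _ at hgap
  -- A gap above `ε` bounds `A` by `D²/(2ε)`, hence the iteration count itself. Only the iterate at
  -- `T` enters, so no monotonicity of the gap is needed to cover all later iterates.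
  by_contra! hcon
  set A := (alen f L m α σ z₀ T).A
  have hAε : A * ε ≤ D ^ 2 / 2 := (mul_le_mul_of_nonneg_left hcon.le hA).trans hgap
  have h1 : A * (√2 * (L / m) * D) ≤ (m : ℝ)⁻¹ * (L * D ^ 3 / ε) := by
    have hsq : √2 ≤ 2 := by rw [Real.sqrt_le_iff]; norm_num
    have hA2 : A ≤ D ^ 2 / 2 / ε := by rw [le_div_iff₀ hε]; exact hAε
    calc A * (√2 * (L / m) * D) ≤ D ^ 2 / 2 / ε * (2 * (L / m) * D) := by gcongr
      _ = _ := by field_simp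
  have h2 : (A * (√2 * (L / m) * D)) ^ (2 / 7 : ℝ) ≤
      (m : ℝ) ^ (-(2 / 7) : ℝ) * (L * D ^ 3 / ε) ^ (2 / 7 : ℝ) := by
    rw [Real.rpow_neg hm0.le, ← Real.inv_rpow hm0.le,
      ← Real.mul_rpow (by positivity) (by positivity)]
    exact Real.rpow_le_rpow (by positivity) h1 (by norm_num)
  have h3 : (T : ℝ) ≤ iterConst (Real.log α / 2) *
      ((m : ℝ) ^ (-(2 / 7) : ℝ) * (L * D ^ 3 / ε) ^ (2 / 7 : ℝ)) :=
    hTA.trans (mul_le_mul_of_nonneg_left h2 (iterConst_pos hβ).le)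
  have h4 : T ≤ ⌊iterConst (Real.log α / 2) *
      ((m : ℝ) ^ (-(2 / 7) : ℝ) * (L * D ^ 3 / ε) ^ (2 / 7 : ℝ))⌋₊ := Nat.le_floor h3
  unfold outerIterations at hT
  omega

lemma alen_counts {E : Type*} [NormedAddCommGroup E] [InnerProductSpace ℝ E]
    [CompleteSpace E] (f : E → ℝ) {L α σ D ε : ℝ} {m : ℕ} (hL : 0 < L) (hm : 1 ≤ m)
    (hα : 1 < α) (hσ : 0 < σ) (hσ' : σ ≤ 99 / 100) (hD : 0 < D) (hε : 0 < ε) (z₀ : E) :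
    ((alen f L m α σ z₀ (outerIterations α L D ε m)).hessians : ℝ) ≤
      1478 * (iterConst (Real.log α / 2) + 1) *
        ((1 + (m : ℝ) ^ (-(2 / 7) : ℝ) * (L * D ^ 3 / ε) ^ (2 / 7 : ℝ)) * (1 + Real.log m)) ∧
    ((alen f L m α σ z₀ (outerIterations α L D ε m)).steps : ℝ) ≤
      1478 * (iterConst (Real.log α / 2) + 1) *
        ((m + (m : ℝ) ^ (5 / 7 : ℝ) * (L * D ^ 3 / ε) ^ (2 / 7 : ℝ)) * (1 + Real.log m)) := by
  have hm1 : (1 : ℝ) ≤ m := by exact_mod_cast hm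
  have hm0 : (0 : ℝ) < m := by linarith
  have hlm : 0 ≤ Real.log m := Real.log_nonneg hm1
  have hβ : 0 < Real.log α / 2 := by have := Real.log_pos hα; positivity
  have hC := iterConst_pos hβ
  set Y := (m : ℝ) ^ (-(2 / 7) : ℝ) * (L * D ^ 3 / ε) ^ (2 / 7 : ℝ) with hY
  have hY0 : 0 ≤ Y := by positivity
  set C₀ := iterConst (Real.log α / 2)
  have hT : (outerIterations α L D ε m : ℝ) ≤ (C₀ + 1) * (1 + Y) := by
    have h1 : (⌊C₀ * Y⌋₊ : ℝ) ≤ C₀ * Y := Nat.floor_le (by positivity)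
    unfold outerIterations
    push_cast
    nlinarith
  have hS := epochs_le hL hm hσ hσ'
  set S := ⌈(paramK σ L (L / m) m : ℝ) / (m : ℝ)⌉₊
  have hcount := run_counts (f := f) (α := α) (γ := L / m) (z₀ := z₀)
    (msSolver_steps f L (paramK σ L (L / m) m) (paramM L (L / m) m) m (L / m))
    ⌊C₀ * Y⌋₊
  have hsteps : (alen f L m α σ z₀ (outerIterations α L D ε m)).steps =
      outerIterations α L D ε m * (S * m + 2) := hcount.1
  have hhess : (alen f L m α σ z₀ (outerIterations α L D ε m)).hessians =
      outerIterations α L D ε m * (S + 2) := hcount.2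
  have hh : ((alen f L m α σ z₀ (outerIterations α L D ε m)).hessians : ℝ) ≤
      1478 * (C₀ + 1) * ((1 + Y) * (1 + Real.log m)) := by
    rw [hhess]
    push_cast
    calc _ ≤ ((C₀ + 1) * (1 + Y)) * (1478 * (1 + Real.log m)) := by gcongr
      _ = _ := by ring
  refine ⟨hh, ?_⟩
  have hmY : (m : ℝ) ^ (5 / 7 : ℝ) * (L * D ^ 3 / ε) ^ (2 / 7 : ℝ) = m * Y := by
    rw [hY, ← mul_assoc]
    congr 1
    rw [show (5 / 7 : ℝ) = 1 + -(2 / 7) by norm_num, Real.rpow_add hm0, Real.rpow_one]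
  rw [hmY, hsteps]
  push_cast
  have h2 : (S : ℝ) * m + 2 ≤ m * (1478 * (1 + Real.log m)) := by nlinarith
  calc _ ≤ ((C₀ + 1) * (1 + Y)) * (m * (1478 * (1 + Real.log m))) := by gcongr
    _ = _ := by ring

end Complexity

end ALEN

end

theorem theorem4 (α σ : ℝ) (hα : 1 < α) (hσ : 0 < σ) (hσ' : σ ≤ 99 / 100) :
    ∃ C : ℝ, 0 < C ∧ ∀ (L : ℝ) (m : ℕ), 0 < L → 1 ≤ m →
      ALEN.paramM L (L / m) m ≤ C * (m * L) ∧
      (ALEN.paramK σ L (L / m) m : ℝ) ≤ C * (m * (1 + Real.log m)) ∧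
      ∀ D ε : ℝ, 0 < D → 0 < ε → ∃ T : ℕ,
        ∀ (d : ℕ) (f : EuclideanSpace ℝ (Fin d) → ℝ) (z₀ zstar : EuclideanSpace ℝ (Fin d)),
          ConvexOn ℝ Set.univ f → ALEN.HasLipschitzHessian f L →
          (∀ z, f zstar ≤ f z) → f zstar < f z₀ → ‖z₀ - zstar‖ ≤ D →
            (∀ T' : ℕ, T ≤ T' → f (ALEN.alen f L m α σ z₀ T').z - f zstar ≤ ε) ∧
            ((ALEN.alen f L m α σ z₀ T).steps : ℝ) ≤
              C * ((m + (m : ℝ) ^ (5 / 7 : ℝ) * (L * D ^ 3 / ε) ^ (2 / 7 : ℝ)) *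
                (1 + Real.log m)) ∧
            (ε ≤ L * D ^ 3 / m →
              ((ALEN.alen f L m α σ z₀ T).steps : ℝ) ≤
                C * (m + (m : ℝ) ^ (5 / 7 : ℝ) * (1 + Real.log m) *
                  (L * D ^ 3 / ε) ^ (2 / 7 : ℝ))) ∧
            ((ALEN.alen f L m α σ z₀ T).hessians : ℝ) ≤
              C * ((1 + (m : ℝ) ^ (-(2 / 7) : ℝ) * (L * D ^ 3 / ε) ^ (2 / 7 : ℝ)) *
                (1 + Real.log m)) := by
  have hβ : 0 < Real.log α / 2 := by have := Real.log_pos hα; positivity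
  have hC₀ := ALEN.iterConst_pos hβ
  set C₀ := ALEN.iterConst (Real.log α / 2) with hC₀d
  refine ⟨2956 * (C₀ + 1), by positivity, fun L m hL hm => ?_⟩
  have hm1 : (1 : ℝ) ≤ m := by exact_mod_cast hm
  have hm0 : (0 : ℝ) < m := by linarith
  have hlm : 0 ≤ Real.log m := Real.log_nonneg hm1
  refine ⟨(ALEN.paramM_le hL hm).trans ?_, (ALEN.paramK_le hL hm hσ hσ').trans ?_, ?_⟩
  · gcongr
    linarith
  · gcongr
    linarith
  intro D ε hD hε
  refine ⟨ALEN.outerIterations α L D ε m, fun d f z₀ zs hc hf hmin hz₀ hD0 => ?_⟩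
  obtain ⟨hhess, hsteps⟩ := ALEN.alen_counts f hL hm hα hσ hσ' hD hε z₀
  rw [← hC₀d] at hhess hsteps
  have hCC : 1478 * (C₀ + 1) ≤ 2956 * (C₀ + 1) := by linarith
  refine ⟨fun T' hT' => ALEN.alen_gap_le hc hf hL hm hα hσ hD hε hmin hz₀ hD0 hT',
    hsteps.trans (by gcongr), fun hεm => hsteps.trans ?_, hhess.trans (by gcongr)⟩
  -- For small `ε` the term `m` is dominated by the other one, so the logarithm can be moved off it;
  -- doubling the constant from `1478` to `2956` pays for this.
  have hmX : (m : ℝ) ≤ (m : ℝ) ^ (5 / 7 : ℝ) * (L * D ^ 3 / ε) ^ (2 / 7 : ℝ) := by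
    have h1 : (m : ℝ) ≤ L * D ^ 3 / ε := by
      rw [le_div_iff₀ hm0] at hεm
      rw [le_div_iff₀ hε]
      linarith
    calc (m : ℝ) = (m : ℝ) ^ (5 / 7 : ℝ) * (m : ℝ) ^ (2 / 7 : ℝ) := by
          rw [← Real.rpow_add hm0]; norm_num
      _ ≤ _ := by gcongr
  set X := (L * D ^ 3 / ε) ^ (2 / 7 : ℝ)
  calc 1478 * (C₀ + 1) * ((m + (m : ℝ) ^ (5 / 7 : ℝ) * X) * (1 + Real.log m))
      ≤ 1478 * (C₀ + 1) *
        (((m : ℝ) ^ (5 / 7 : ℝ) * X + (m : ℝ) ^ (5 / 7 : ℝ) * X) * (1 + Real.log m)) := by gcongr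
    _ = 2956 * (C₀ + 1) * ((m : ℝ) ^ (5 / 7 : ℝ) * (1 + Real.log m) * X) := by ring
    _ ≤ _ := by gcongr; linarith
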